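/- Let $\kappa\in\mathbb R$ and let $M_\kappa^2$ be the simply connected complete surface of constant curvature $\kappa$ (the hyperbolic plane with its distance multiplied by $1/\sqrt{-\kappa}$ if $\kappa<0$, the Euclidean plane if $\kappa=0$, the unit sphere with its intrinsic distance multiplied by $1/\sqrt{\kappa}$ if $\kappa>0$). A \emph{geodesic triangle} in $M_\kappa^2$ is given by three points $A,B,C$, not on a common geodesic line and, if $\kappa>0$, lying in a common open hemisphere; its sides $a=BC$, $b=CA$, $c=AB$ are the minimal geodesic segments between its vertices, and $\alpha,\beta,\gamma$ are its angles at $A,B,C$. Let $D,E,F$ be the midpoints of $BC$, $CA$, $AB$. The medial subdivision of $ABC$ consists of the four triangles with labelled vertices $(A',B',C')$ equal to $(D,E,F)$, $(A,F,E)$, $(F,B,D)$ or $(E,D,C)$. A \emph{nested sequence} is a sequence of labelled triangles $t_0,t_1,t_2,\dots$ such that $t_0$ is a geodesic triangle and, for every $n$, $t_{n+1}$ is one of the four labelled triangles of the medial subdivision of $t_n$. Write $\alpha_n,\beta_n,\gamma_n$ for the angles of $t_n$ at its vertices $A_n,B_n,C_n$. \textbf{Theorem B.} For every geodesic triangle $t_0$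 in $M_\kappa^2$ there are constants $l_\alpha=l_\alpha(t_0)>0$ and $L_\alpha=L_\alpha(t_0)>0$ such that, for every nested sequence $t_0,t_1,\dots$ starting with $t_0$ and every $n\in\mathbb N$, \[ \alpha_0\cdot l_\alpha<\alpha_n<\alpha_0\cdot L_\alpha , \] and likewise for $\beta_n$ and $\gamma_n$ with constants $l_\beta,L_\beta$ and $l_\gamma,L_\gamma$. Moreover these constants can be chosen so that the lower ones tend to $1$ from below and the upper ones tend to $1$ from above as all side lengths of $t_0$ tend to $0$: for every $\varepsilon>0$ there is $\delta>0$ such that, whenever all side lengths of $t_0$ are less than $\delta$, we have $1-\varepsilon<l_\alpha(t_0)<1<L_\alpha(t_0)<1+\varepsilon$, and likewise for $\beta$ and $\gamma$. -/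

import Mathlib

noncomputable section

namespace MedialSubdivision

/-- The data of a plane geometry used below: its points, its distance function, the angle
`angle q p r` at `p` between the minimal geodesics from `p` to `q` and from `p` to `r`, and which
labelled triples of points are vertices of a (non-degenerate) geodesic triangle.
It is only ever used for the three geometries constructed below and their rescalings. -/
structure PlaneGeometry where
  Point : Type
  dist : Point → Point → ℝ
  angle : Point → Point → Point → ℝ
  IsTriangle : (Fin 3 → Point) → Prop

/-! ### The hyperbolic plane (hyperboloid model) -/

/-- The Lorentz form on `ℝ³`. -/
def lorentz (x y : Fin 3 → ℝ) : ℝ := x 0 * y 0 + x 1 * y 1 - x 2 * y 2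

/-- The upper sheet of the hyperboloid. -/
abbrev Hyperboloid : Type := {x : Fin 3 → ℝ // lorentz x x = -1 ∧ 0 < x 2}

/-- The Lorentz-orthogonal projection of `q` to the tangent plane at `p`. For `q ≠ p` this is a
positive multiple of the initial velocity of the geodesic from `p` to `q`. -/
def hypDir (p q : Hyperboloid) : Fin 3 → ℝ := q.1 + lorentz p.1 q.1 • p.1

/-- The hyperbolic plane of curvature `-1`. Triangles are triples of points which do not lie on a
common geodesic line, the lines being the sections of the hyperboloid by planes through `0`. -/
def hyperbolicPlane : PlaneGeometry where
  Point := Hyperboloid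
  dist p q := Real.arcosh (-lorentz p.1 q.1)
  angle q p r := Real.arccos (lorentz (hypDir p q) (hypDir p r) /
    (√(lorentz (hypDir p q) (hypDir p q)) * √(lorentz (hypDir p r) (hypDir p r))))
  IsTriangle t := LinearIndependent ℝ fun i => (t i).1

/-! ### The Euclidean plane -/

/-- The Euclidean plane. -/
def euclideanPlane : PlaneGeometry where
  Point := EuclideanSpace ℝ (Fin 2)
  dist p q := Dist.dist p q
  angle q p r := EuclideanGeometry.angle q p r
  IsTriangle t := AffineIndependent ℝ t

/-! ### The sphere -/

/-- The unit sphere of `ℝ³`. -/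
abbrev Sphere2 : Type := Metric.sphere (0 : EuclideanSpace ℝ (Fin 3)) 1

/-- The orthogonal projection of `q` to the tangent plane at `p`. For `q ≠ ± p` this is a positive
multiple of the initial velocity of the minimal geodesic from `p` to `q`. -/
def sphDir (p q : Sphere2) : EuclideanSpace ℝ (Fin 3) := q.1 - inner ℝ p.1 q.1 • p.1

/-- The sphere of curvature `1` with its intrinsic distance. Triangles are triples of points in a
common open hemisphere which do not lie on a common great circle. -/
def unitSphere : PlaneGeometry where
  Point := Sphere2
  dist p q := InnerProductGeometry.angle p.1 q.1
  angle q p r := InnerProductGeometry.angle (sphDir p q) (sphDir p r)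
  IsTriangle t := LinearIndependent ℝ (fun i => (t i).1) ∧
    ∃ v : EuclideanSpace ℝ (Fin 3), ∀ i, 0 < inner ℝ v (t i).1

/-! ### The surfaces of constant curvature -/

/-- Multiply the distance function by `c`. -/
def PlaneGeometry.rescale (c : ℝ) (M : PlaneGeometry) : PlaneGeometry :=
  { M with dist := fun p q => c * M.dist p q }

/-- The simply connected surface of constant curvature `κ`. -/
def constCurv (κ : ℝ) : PlaneGeometry :=
  if κ < 0 then hyperbolicPlane.rescale (1 / √(-κ))
  else if κ = 0 then euclideanPlane
  else unitSphere.rescale (1 / √κ)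

/-! ### The medial subdivision -/

namespace PlaneGeometry

variable (M : PlaneGeometry)

/-- `m` is the midpoint of `p` and `q`. -/
def IsMidpoint (m p q : M.Point) : Prop :=
  M.dist p m = M.dist p q / 2 ∧ M.dist m q = M.dist p q / 2

/-- The angle of the triangle `t` at its vertex `i`. -/
def vertexAngle (t : Fin 3 → M.Point) (i : Fin 3) : ℝ :=
  M.angle (t (i + 1)) (t i) (t (i + 2))

/-- `t'` is the innermost triangle of the medial subdivision of `t`; its vertex `i` is the midpoint
of the side of `t` opposite to the vertex `i`, so that its side `i` (the one opposite to vertex `i`)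
is the one which does not meet the side `i` of `t`. -/
def IsInner (t t' : Fin 3 → M.Point) : Prop :=
  ∀ i, M.IsMidpoint (t' i) (t (i + 1)) (t (i + 2))

/-- `t'` is the outer triangle of the medial subdivision of `t` at the vertex `k`; its two sides
through `t k` keep the label of the side of `t` in which they are contained. -/
def IsOuter (k : Fin 3) (t t' : Fin 3 → M.Point) : Prop :=
  t' k = t k ∧ ∀ i, i ≠ k → M.IsMidpoint (t' i) (t k) (t i)

/-- `t 0, t 1, …` is a nested sequence of labelled subdivision triangles. -/
def IsNested (t : ℕ → Fin 3 → M.Point) : Prop :=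
  M.IsTriangle (t 0) ∧
    ∀ n, M.IsInner (t n) (t (n + 1)) ∨ ∃ k, M.IsOuter k (t n) (t (n + 1))

end PlaneGeometry

end MedialSubdivision

end

noncomputable section

namespace MedialSubdivision

/-! For `κ ≠ 0`, scaling reduces to the sphere (`σ = 1`) and the hyperboloid (`σ = -1`), where
points are unit vectors of a quadratic form on `ℝ³` and midpoints are normalised sums. If `u, v, w`
are the (hyperbolic) cosines of the sides, the law of cosines reads cot α = σ(u - vw) / √`gram u v
w`. Passing to a subdivision triangle multiplies the Gram determinant by an explicit factor. Once
this factor is scaled away, either the angle is unchanged (outer triangle at the same vertex) or the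
numerator has become σp(1 + u - v - w), with p close to 1. Since 1 + u - v - w differs from u - vw
by (1 - v)(1 - w), the numerator moves by at most a multiple of m · √((1 - v²)(1 - w²)), where m is
the sum of the three |1 - cos|.

A cotangent perturbation measured against this hypotenuse changes the angle by a proportion of the
angle itself, however thin the triangle (`abs_polarAngle_sub_le`). So one step changes each angle by
a factor 1 + O(m) (`IsTri.abs_triAngle_sub_le`). For small triangles m at least halves in each step,
the errors form a geometric series, and the constants are 1 + O(m) (`orbit_bounds_of_small`).

A large triangle becomes small after a number N of steps that does not depend on the choices made:
in the hyperbolic case m always halves, and on the sphere a gnomonic projection turns subdivision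
into a uniform contraction (`eventually_small_of_pos`). Only finitely many triangles occur in the
first N steps, so minima and maxima over them give the constants. In the Euclidean plane the angles
do not change at all. -/

/-! ### Angles in terms of a cotangent -/

/-- The angle in `(0, π)` of a vector with coordinates `(x, √R)`. -/
def polarAngle (x R : ℝ) : ℝ := Real.arccos (x / √(x ^ 2 + R))

/-- Homogeneity: only the ratio of the coordinates `(x, √R)` matters. This absorbs the change of the
Gram determinant under subdivision. -/
theorem polarAngle_mul {k R : ℝ} (hk : 0 < k) (x : ℝ) :
    polarAngle (k * x) (k ^ 2 * R) = polarAngle x R := by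
  have h : √((k * x) ^ 2 + k ^ 2 * R) = k * √(x ^ 2 + R) := by
    rw [show (k * x) ^ 2 + k ^ 2 * R = k ^ 2 * (x ^ 2 + R) by ring,
      Real.sqrt_mul (by positivity), Real.sqrt_sq hk.le]
  rw [polarAngle, polarAngle, h, mul_div_mul_left _ _ hk.ne']

theorem abs_div_sqrt_lt_one {x R : ℝ} (hR : 0 < R) : |x / √(x ^ 2 + R)| < 1 := by
  have hr : 0 < √(x ^ 2 + R) := Real.sqrt_pos.2 (by positivity)
  rw [abs_div, abs_of_pos hr, div_lt_one hr]
  exact Real.lt_sqrt_of_sq_lt (by rw [sq_abs]; linarith)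

theorem cos_polarAngle {x R : ℝ} (hR : 0 < R) :
    Real.cos (polarAngle x R) = x / √(x ^ 2 + R) :=
  Real.cos_arccos (abs_lt.1 (abs_div_sqrt_lt_one hR)).1.le (abs_lt.1 (abs_div_sqrt_lt_one hR)).2.le

theorem sin_polarAngle {x R : ℝ} (hR : 0 < R) :
    Real.sin (polarAngle x R) = √R / √(x ^ 2 + R) := by
  have hr : 0 < x ^ 2 + R := by positivity
  rw [polarAngle, Real.sin_arccos, div_pow, Real.sq_sqrt hr.le, ← Real.sqrt_div hR.le]
  congr 1
  field_simp
  ring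

theorem polarAngle_pos {x R : ℝ} (hR : 0 < R) : 0 < polarAngle x R :=
  Real.arccos_pos.2 (abs_lt.1 (abs_div_sqrt_lt_one hR)).2

theorem polarAngle_le_pi (x R : ℝ) : polarAngle x R ≤ Real.pi := Real.arccos_le_pi _

/-- Perturbing the cotangent of an angle changes the angle by a controlled proportion. -/
theorem abs_polarAngle_sub_le {x y R η : ℝ} (hR : 0 < R) (hη : η ≤ 1 / 2)
    (h : |y - x| ≤ η * √(x ^ 2 + R)) :
    |polarAngle y R - polarAngle x R| ≤ Real.pi * η * polarAngle x R := by
  set r := √(x ^ 2 + R) with hr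
  set r' := √(y ^ 2 + R) with hr'
  have hr0 : 0 < r := Real.sqrt_pos.2 (by positivity)
  have hr0' : 0 < r' := Real.sqrt_pos.2 (by positivity)
  have hrsq : r ^ 2 = x ^ 2 + R := Real.sq_sqrt (by positivity)
  have hrsq' : r' ^ 2 = y ^ 2 + R := Real.sq_sqrt (by positivity)
  have hRsq : √R ^ 2 = R := Real.sq_sqrt hR.le
  have hη0 : 0 ≤ η := by
    by_contra hneg
    have := (abs_nonneg _).trans h
    nlinarith
  have hxr : |x| ≤ r := Real.abs_le_sqrt (by linarith)
  have hyx : |y - x| ≤ r / 2 := h.trans (by nlinarith)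
  set θ := polarAngle x R with hθ
  set θ' := polarAngle y R with hθ'
  have hθ0 : 0 < θ := polarAngle_pos hR
  have hθ0' : 0 < θ' := polarAngle_pos hR
  have hθπ : θ ≤ Real.pi := polarAngle_le_pi _ _
  have hθπ' : θ' ≤ Real.pi := polarAngle_le_pi _ _
  -- The numerator of the cosine is x y + R = r² + x (y - x) ≥ r²/2. The angular change is therefore
  -- acute, as Jordan's inequality below requires.
  have hcos : 0 < Real.cos |θ' - θ| := by
    rw [Real.cos_abs, Real.cos_sub, cos_polarAngle hR, cos_polarAngle hR, sin_polarAngle hR,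
      sin_polarAngle hR, ← hr, ← hr', div_mul_div_comm, div_mul_div_comm, ← add_div]
    apply div_pos _ (by positivity)
    have h1 : |x * (y - x)| ≤ r * (r / 2) := by
      rw [abs_mul]; exact mul_le_mul hxr hyx (abs_nonneg _) hr0.le
    have h2 := (abs_le.1 h1).1
    nlinarith
  have hlt : |θ' - θ| < Real.pi / 2 := by
    by_contra hge
    have h1 : |θ' - θ| ≤ Real.pi := abs_le.2 ⟨by linarith, by linarith⟩
    exact absurd hcos (not_lt.2 (Real.cos_nonpos_of_pi_div_two_le_of_le (not_lt.1 hge)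
      (by linarith)))
  have hr2 : r / 2 ≤ r' := by
    apply Real.le_sqrt_of_sq_le
    have h1 := abs_le.1 hyx
    have h2 := abs_le.1 hxr
    nlinarith [sq_nonneg (x + 2 * (y - x)), sq_abs (y - x), abs_nonneg (y - x)]
  -- The sine of the change is √R |y - x| / (r r'), which carries the factor √R / r = sin θ. This
  -- makes the error proportional to θ and not merely small.
  have hsin : Real.sin |θ' - θ| ≤ 2 * η * Real.sin θ := by
    have h1 : Real.sin (θ' - θ) = √R * (x - y) / (r' * r) := by
      rw [Real.sin_sub, cos_polarAngle hR, cos_polarAngle hR, sin_polarAngle hR,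
        sin_polarAngle hR, ← hr, ← hr']
      field_simp
    have h2 : Real.sin |θ' - θ| = √R * |y - x| / (r' * r) := by
      have h3 : 0 ≤ Real.sin |θ' - θ| :=
        Real.sin_nonneg_of_nonneg_of_le_pi (abs_nonneg _) (by linarith)
      have h4 : Real.sin |θ' - θ| = |Real.sin (θ' - θ)| := by
        rcases abs_cases (θ' - θ) with ⟨h, _⟩ | ⟨h, _⟩
        · rw [h] at h3 ⊢; rw [abs_of_nonneg h3]
        · rw [h] at h3 ⊢; rw [Real.sin_neg] at h3 ⊢; rw [abs_of_nonpos (by linarith)]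
      rw [h4, h1, abs_div, abs_mul, abs_of_nonneg (Real.sqrt_nonneg R), abs_sub_comm,
        abs_of_pos (by positivity : 0 < r' * r)]
    rw [h2, sin_polarAngle hR, ← hr, ← mul_div_assoc, div_le_div_iff₀ (by positivity) hr0]
    have h5 : |y - x| ≤ 2 * η * r' := h.trans (by nlinarith)
    calc √R * |y - x| * r ≤ √R * (2 * η * r') * r := by gcongr
      _ = 2 * η * √R * (r' * r) := by ring
  have hj : 2 / Real.pi * |θ' - θ| ≤ Real.sin |θ' - θ| := Real.mul_le_sin (abs_nonneg _) hlt.le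
  have hs : Real.sin θ ≤ θ := Real.sin_le hθ0.le
  have hpi := Real.pi_pos
  have : |θ' - θ| ≤ Real.pi / 2 * (2 * η * θ) := by
    calc |θ' - θ| = Real.pi / 2 * (2 / Real.pi * |θ' - θ|) := by field_simp
      _ ≤ Real.pi / 2 * (2 * η * θ) :=
        mul_le_mul_of_nonneg_left (hj.trans (hsin.trans (by gcongr))) (by positivity)
  linarith

/-! ### Almost invariant quantities along iterated subdivisions -/

/-- `s` is a sequence each of whose terms arises from the preceding one by one of the maps
`step k`. -/
def IsOrbit {τ κ : Type*} (step : κ → τ → τ) (s : ℕ → τ) : Prop := ∀ n, ∃ k, s (n + 1) = step k (s n)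

section Orbit

variable {τ κ : Type*} {step : κ → τ → τ} {T : τ → Prop} {a M : τ → ℝ} {C s₀ : ℝ}

/-- With c = C · M (s 0), the n-th relative error is at most c / 2ⁿ, of total 2c. The lower bound
uses this directly; the upper one uses ∏ (1 + c / 2ⁿ) ≤ 1 + 4c, valid for c ≤ 1/4. -/
theorem orbit_bounds_of_small (hT : ∀ t k, T t → T (step k t)) (ha : ∀ t, T t → 0 < a t)
    (hM : ∀ t, T t → 0 < M t) (hC : 0 < C)
    (herr : ∀ t k, T t → M t ≤ s₀ → |a (step k t) - a t| ≤ C * M t * a t)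
    (hcontr : ∀ t k, T t → M t ≤ s₀ → M (step k t) ≤ M t / 2)
    {s : ℕ → τ} (hs : IsOrbit step s) (h0 : T (s 0)) (hs₀ : M (s 0) ≤ s₀)
    (hsC : C * M (s 0) ≤ 1 / 4) (n : ℕ) :
    a (s 0) * (1 - 2 * C * M (s 0)) < a (s n) ∧ a (s n) < a (s 0) * (1 + 4 * C * M (s 0)) := by
  have hM0 := hM _ h0
  have ha0 := ha _ h0
  -- The factor 1 - (1/2)ⁿ tracks the partial sums of the geometric series; as it stays below 1, the
  -- final inequalities are strict.
  have key : ∀ n, T (s n) ∧ M (s n) ≤ M (s 0) * (1 / 2) ^ n ∧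
      a (s 0) * (1 - 2 * (C * M (s 0)) * (1 - (1 / 2) ^ n)) ≤ a (s n) ∧
      a (s n) ≤ a (s 0) * (1 + 4 * (C * M (s 0)) * (1 - (1 / 2) ^ n)) := by
    intro n
    induction n with
    | zero => simp [h0]
    | succ n ih =>
      obtain ⟨ht, hm, hl, hu⟩ := ih
      obtain ⟨k, hk⟩ := hs n
      have hp0 : (0 : ℝ) < (1 / 2) ^ n := by positivity
      have hp1 : ((1 : ℝ) / 2) ^ n ≤ 1 := pow_le_one₀ (by norm_num) (by norm_num)
      have hms : M (s n) ≤ s₀ := hm.trans (by nlinarith)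
      have e := abs_le.1 (herr _ k ht hms)
      have c := hcontr _ k ht hms
      have han := ha _ ht
      rw [← hk] at e c
      set p : ℝ := (1 / 2) ^ n with hp
      set c₀ := C * M (s 0) with hc₀
      have hc0 : 0 < c₀ := by positivity
      have hcm : C * M (s n) ≤ c₀ * p := by
        rw [hc₀, mul_assoc]; exact mul_le_mul_of_nonneg_left hm hC.le
      have he : C * M (s n) * a (s n) ≤ c₀ * p * a (s n) := by gcongr
      have hcp : c₀ * p ≤ 1 / 4 := by nlinarith
      refine ⟨hk ▸ hT _ k ht, by rw [pow_succ]; linarith, ?_, ?_⟩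
      · rw [pow_succ, ← hp]
        have h1 : (1 - c₀ * p) * (a (s 0) * (1 - 2 * c₀ * (1 - p))) ≤ (1 - c₀ * p) * a (s n) :=
          mul_le_mul_of_nonneg_left hl (by linarith)
        have h2 : 0 ≤ a (s 0) * (c₀ * p * (2 * c₀ * (1 - p))) := by
          have : 0 ≤ 1 - p := by linarith
          positivity
        nlinarith
      · rw [pow_succ, ← hp]
        have h1 : (1 + c₀ * p) * a (s n) ≤ (1 + c₀ * p) * (a (s 0) * (1 + 4 * c₀ * (1 - p))) :=
          mul_le_mul_of_nonneg_left hu (by positivity)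
        have h2 : 0 ≤ a (s 0) * (c₀ * p * (1 - 4 * c₀ * (1 - p))) := by
          have : 0 ≤ 1 - 4 * c₀ * (1 - p) := by nlinarith
          positivity
        nlinarith
  obtain ⟨-, -, hl, hu⟩ := key n
  have hp0 : (0 : ℝ) < (1 / 2) ^ n := by positivity
  have hpos : 0 < a (s 0) * (C * M (s 0)) * (1 / 2) ^ n := by positivity
  constructor <;> nlinarith

/-- Induction on the number of steps until the orbit is small. Finiteness of the set of steps allows
a minimum and a maximum over all first moves. -/
theorem exists_orbit_bounds_of_eventually_small [Finite κ] [Nonempty κ]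
    (hT : ∀ t k, T t → T (step k t)) (ha : ∀ t, T t → 0 < a t)
    (hM : ∀ t, T t → 0 < M t) (hC : 0 < C)
    (herr : ∀ t k, T t → M t ≤ s₀ → |a (step k t) - a t| ≤ C * M t * a t)
    (hcontr : ∀ t k, T t → M t ≤ s₀ → M (step k t) ≤ M t / 2) (N : ℕ) :
    ∀ t, T t → (∀ s, IsOrbit step s → s 0 = t → M (s N) ≤ s₀ ∧ C * M (s N) ≤ 1 / 4) →
      ∃ l > 0, ∃ L > 0, ∀ s, IsOrbit step s → s 0 = t → ∀ n, l < a (s n) ∧ a (s n) < L := by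
  induction N with
  | zero =>
    intro t ht h
    have hat := ha _ ht
    refine ⟨a t / 2, by positivity, a t * 2, by positivity, ?_⟩
    rintro s hs rfl n
    obtain ⟨h1, h2⟩ := h s hs rfl
    have := orbit_bounds_of_small hT ha hM hC herr hcontr hs ht h1 h2 n
    constructor <;> nlinarith
  | succ N ih =>
    intro t ht h
    have hat := ha _ ht
    have key : ∀ k, ∃ l > 0, ∃ L > 0, ∀ s, IsOrbit step s → s 0 = step k t →
        ∀ n, l < a (s n) ∧ a (s n) < L := by
      intro k
      apply ih _ (hT _ k ht)
      intro s hs hs0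
      -- An orbit from `step k t` is prolonged backwards by `t`.
      refine h (fun n => Nat.casesOn n t s) ?_ rfl
      intro n
      cases n with
      | zero => exact ⟨k, hs0⟩
      | succ n => exact hs n
    choose l hl L hL hlL using key
    obtain ⟨k₁, hk₁⟩ := Finite.exists_min l
    obtain ⟨k₂, hk₂⟩ := Finite.exists_max L
    refine ⟨min (a t / 2) (l k₁), lt_min (by positivity) (hl _), max (a t * 2) (L k₂),
      lt_max_of_lt_left (by positivity), ?_⟩
    rintro s hs rfl n
    cases n with
    | zero => exact ⟨min_lt_of_left_lt (by linarith), lt_max_of_lt_left (by linarith)⟩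
    | succ n =>
      obtain ⟨k, hk⟩ := hs 0
      have := hlL k (fun n => s (n + 1)) (fun n => hs (n + 1)) hk n
      exact ⟨min_lt_of_right_lt ((hk₁ k).trans_lt this.1),
        lt_max_of_lt_right (this.2.trans_le (hk₂ k))⟩

theorem exists_orbit_bounds [Finite κ] [Nonempty κ]
    (hT : ∀ t k, T t → T (step k t)) (ha : ∀ t, T t → 0 < a t)
    (hM : ∀ t, T t → 0 < M t) (hC : 0 < C) (hs₀ : 0 < s₀)
    (herr : ∀ t k, T t → M t ≤ s₀ → |a (step k t) - a t| ≤ C * M t * a t)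
    (hcontr : ∀ t k, T t → M t ≤ s₀ → M (step k t) ≤ M t / 2)
    (hev : ∀ t, T t → ∀ δ > 0, ∃ N, ∀ s, IsOrbit step s → s 0 = t → M (s N) ≤ δ) :
    ∃ l L : τ → ℝ, (∀ t, T t → 0 < l t ∧ 0 < L t) ∧
      (∀ s, IsOrbit step s → T (s 0) → ∀ n,
        a (s 0) * l (s 0) < a (s n) ∧ a (s n) < a (s 0) * L (s 0)) ∧
      (∀ t, M t ≤ s₀ → C * M t ≤ 1 / 4 → l t = 1 - 2 * C * M t ∧ L t = 1 + 4 * C * M t) := by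
  have key : ∀ t, ∃ l L : ℝ, (T t → 0 < l ∧ 0 < L) ∧
      (T t → ∀ s, IsOrbit step s → s 0 = t → ∀ n, a t * l < a (s n) ∧ a (s n) < a t * L) ∧
      (M t ≤ s₀ → C * M t ≤ 1 / 4 → l = 1 - 2 * C * M t ∧ L = 1 + 4 * C * M t) := by
    intro t
    -- For small `t` the explicit constants must be chosen, since they yield the limit 1; otherwise
    -- any positive constants serve.
    by_cases hsm : M t ≤ s₀ ∧ C * M t ≤ 1 / 4
    · refine ⟨_, _, ?_, ?_, fun _ _ => ⟨rfl, rfl⟩⟩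
      · intro ht
        have := mul_pos hC (hM t ht)
        constructor <;> linarith
      · rintro ht s hs rfl n
        exact orbit_bounds_of_small hT ha hM hC herr hcontr hs ht hsm.1 hsm.2 n
    · by_cases ht : T t
      · obtain ⟨N, hN⟩ := hev t ht (min s₀ (1 / (4 * C))) (by positivity)
        obtain ⟨l, hl, L, hL, h⟩ := exists_orbit_bounds_of_eventually_small hT ha hM hC herr
          hcontr N t ht (fun s hs hst => by
            have := hN s hs hst
            refine ⟨this.trans (min_le_left _ _), ?_⟩
            have h2 := this.trans (min_le_right _ _)
            calc C * M (s N) ≤ C * (1 / (4 * C)) := by gcongr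
              _ = 1 / 4 := by field_simp)
        have hat := ha t ht
        refine ⟨l / a t, L / a t, fun _ => ⟨by positivity, by positivity⟩, fun _ s hs hst n => ?_,
          fun h1 h2 => absurd ⟨h1, h2⟩ hsm⟩
        rw [mul_div_cancel₀ _ hat.ne', mul_div_cancel₀ _ hat.ne']
        exact h s hs hst n
      · exact ⟨_, _, fun h => absurd h ht, fun h => absurd h ht, fun _ _ => ⟨rfl, rfl⟩⟩
  choose l L h1 h2 h3 using key
  exact ⟨l, L, h1, fun s hs h0 n => h2 _ h0 s hs rfl n, h3⟩

end Orbit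

/-! ### Triangles given by the cosines of their sides

Below `σ` is the sign of the curvature and `u, v, w` are `cos a, cos b, cos c` if `σ = 1` and
`cosh a, cosh b, cosh c` if `σ = -1`. -/

/-- The Gram determinant of three vectors of norm one with inner products `u, v, w`. -/
def gram (u v w : ℝ) : ℝ := 1 + 2 * u * v * w - u ^ 2 - v ^ 2 - w ^ 2

/-- The angle opposite to the first side, by the law of cosines. -/
def cosineLawAngle (σ u v w : ℝ) : ℝ :=
  Real.arccos (σ * (u - v * w) / √((1 - v ^ 2) * (1 - w ^ 2)))

/-- The sides of a non-degenerate triangle. -/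
structure IsSides (σ u v w : ℝ) : Prop where
  u_ne : 0 < σ * (1 - u)
  v_ne : 0 < σ * (1 - v)
  w_ne : 0 < σ * (1 - w)
  u_gt : 0 < 1 + u
  v_gt : 0 < 1 + v
  w_gt : 0 < 1 + w
  gram_pos : 0 < gram u v w

/-- The segment between the midpoints of the second and the third side. -/
def midline (u v w : ℝ) : ℝ := (1 + u + v + w) / (2 * √((1 + v) * (1 + w)))

/-- Half of a side. -/
def halfSide (w : ℝ) : ℝ := √((1 + w) / 2)

theorem gram_rotate (u v w : ℝ) : gram v w u = gram u v w := by unfold gram; ring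

theorem gram_swap (u v w : ℝ) : gram u w v = gram u v w := by unfold gram; ring

theorem midline_swap (u v w : ℝ) : midline u w v = midline u v w := by
  unfold midline
  rw [mul_comm (1 + w), show 1 + u + w + v = 1 + u + v + w by ring]

theorem cosineLawAngle_swap (σ u v w : ℝ) :
    cosineLawAngle σ u w v = cosineLawAngle σ u v w := by
  unfold cosineLawAngle
  rw [mul_comm w v, mul_comm (1 - w ^ 2)]

theorem IsSides.rotate {σ u v w : ℝ} (h : IsSides σ u v w) : IsSides σ v w u :=
  ⟨h.v_ne, h.w_ne, h.u_ne, h.v_gt, h.w_gt, h.u_gt, by rw [gram_rotate]; exact h.gram_pos⟩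

theorem IsSides.swap {σ u v w : ℝ} (h : IsSides σ u v w) : IsSides σ u w v :=
  ⟨h.u_ne, h.w_ne, h.v_ne, h.u_gt, h.w_gt, h.v_gt, by rw [gram_swap]; exact h.gram_pos⟩

/-! ### Gram determinants and angles of the subdivision triangles -/

section

variable {σ : ℝ}

theorem cosineLawAngle_eq_polarAngle (hσ : σ = 1 ∨ σ = -1) (u v w : ℝ) :
    cosineLawAngle σ u v w = polarAngle (σ * (u - v * w)) (gram u v w) := by
  have : (σ * (u - v * w)) ^ 2 + gram u v w = (1 - v ^ 2) * (1 - w ^ 2) := by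
    unfold gram
    rcases hσ with rfl | rfl <;> ring
  rw [cosineLawAngle, polarAngle, this]

theorem IsSides.cosineLawAngle_pos (hσ : σ = 1 ∨ σ = -1) {u v w : ℝ} (h : IsSides σ u v w) :
    0 < cosineLawAngle σ u v w := by
  rw [cosineLawAngle_eq_polarAngle hσ]
  exact polarAngle_pos h.gram_pos

theorem midline_sq_sub_one (b c a : ℝ) (hb : 0 < b) (hc : 0 < c) :
    midline (a ^ 2 - 1) (b ^ 2 - 1) (c ^ 2 - 1) = (a ^ 2 + b ^ 2 + c ^ 2 - 2) / (2 * (b * c)) := by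
  unfold midline
  rw [show (1 + (b ^ 2 - 1)) * (1 + (c ^ 2 - 1)) = (b * c) ^ 2 by ring,
    Real.sqrt_sq (by positivity)]
  congr 1
  ring

theorem halfSide_sq_sub_one {c : ℝ} (hc : 0 < c) : halfSide (c ^ 2 - 1) = c / √2 := by
  unfold halfSide
  rw [show (1 + (c ^ 2 - 1)) / 2 = c ^ 2 / 2 by ring, Real.sqrt_div (by positivity),
    Real.sqrt_sq hc.le]

/-- Substituting u = a² - 1 makes `midline` and `halfSide` rational up to √2, which turns the
identities below into polynomial ones. -/
theorem exists_sq_sub_one {u : ℝ} (hu : 0 < 1 + u) : ∃ a, 0 < a ∧ u = a ^ 2 - 1 :=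
  ⟨√(1 + u), Real.sqrt_pos.2 hu, by rw [Real.sq_sqrt hu.le]; ring⟩

/-- For vectors x, y, z the pairwise sums have determinant ±2 det(x, y, z). Squaring and dividing by
the squared lengths 2(1 + u), 2(1 + v), 2(1 + w) gives the factor. -/
theorem gram_inner {u v w : ℝ} (hu : 0 < 1 + u) (hv : 0 < 1 + v) (hw : 0 < 1 + w) :
    gram (midline u v w) (midline v w u) (midline w u v) =
      gram u v w / (2 * (1 + u) * (1 + v) * (1 + w)) := by
  obtain ⟨a, ha, rfl⟩ := exists_sq_sub_one hu
  obtain ⟨b, hb, rfl⟩ := exists_sq_sub_one hv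
  obtain ⟨c, hc, rfl⟩ := exists_sq_sub_one hw
  rw [midline_sq_sub_one b c a hb hc, midline_sq_sub_one c a b hc ha,
    midline_sq_sub_one a b c ha hb]
  unfold gram
  rw [eq_div_iff (by positivity)]
  field_simp
  ring

/-- As for the inner triangle, but x, x + y, x + z have the same determinant as x, y, z. -/
theorem gram_outer {u v w : ℝ} (hu : 0 < 1 + u) (hv : 0 < 1 + v) (hw : 0 < 1 + w) :
    gram (midline u v w) (halfSide v) (halfSide w) = gram u v w / (4 * (1 + v) * (1 + w)) := by
  obtain ⟨a, ha, rfl⟩ := exists_sq_sub_one hu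
  obtain ⟨b, hb, rfl⟩ := exists_sq_sub_one hv
  obtain ⟨c, hc, rfl⟩ := exists_sq_sub_one hw
  have h2 : √2 ^ 2 = (2 : ℝ) := Real.sq_sqrt (by norm_num)
  rw [midline_sq_sub_one b c a hb hc, halfSide_sq_sub_one hb, halfSide_sq_sub_one hc]
  unfold gram
  rw [div_pow b, div_pow c, h2, show ∀ x : ℝ, 2 * x * (b / √2) * (c / √2) = 2 * x * b * c / √2 ^ 2
    from fun x => by ring, h2, eq_div_iff (by positivity)]
  field_simp
  ring

/-- The scaling factor k is the square root of the factor in `gram_inner`. What remains has the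
original Gram determinant, and its first coordinate is σ(1 + u - v - w) times a quantity which tends
to 1 for small triangles. -/
theorem angle_inner (hσ : σ = 1 ∨ σ = -1) {u v w : ℝ} (h : IsSides σ u v w) :
    cosineLawAngle σ (midline u v w) (midline v w u) (midline w u v) =
      polarAngle (σ * ((1 + u + v + w) / 4 / halfSide u * (1 + u - v - w))) (gram u v w) := by
  rw [cosineLawAngle_eq_polarAngle hσ, gram_inner h.u_gt h.v_gt h.w_gt]
  obtain ⟨a, ha, rfl⟩ := exists_sq_sub_one h.u_gt
  obtain ⟨b, hb, rfl⟩ := exists_sq_sub_one h.v_gt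
  obtain ⟨c, hc, rfl⟩ := exists_sq_sub_one h.w_gt
  have h2 : √2 ^ 2 = (2 : ℝ) := Real.sq_sqrt (by norm_num)
  have h20 : (0 : ℝ) < √2 := by positivity
  rw [← polarAngle_mul (k := 1 / (√2 * a * b * c)) (by positivity)
    (σ * ((1 + (a ^ 2 - 1) + (b ^ 2 - 1) + (c ^ 2 - 1)) / 4 / halfSide (a ^ 2 - 1) *
      (1 + (a ^ 2 - 1) - (b ^ 2 - 1) - (c ^ 2 - 1))))]
  rw [midline_sq_sub_one b c a hb hc, midline_sq_sub_one c a b hc ha,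
    midline_sq_sub_one a b c ha hb, halfSide_sq_sub_one ha]
  congr 1
  · field_simp
    ring
  · rw [div_pow, mul_pow, mul_pow, mul_pow, h2]
    field_simp
    ring

/-- Both triangles have the same rays at the common vertex. -/
theorem angle_outer_self (hσ : σ = 1 ∨ σ = -1) {u v w : ℝ} (h : IsSides σ u v w) :
    cosineLawAngle σ (midline u v w) (halfSide v) (halfSide w) = cosineLawAngle σ u v w := by
  rw [cosineLawAngle_eq_polarAngle hσ, gram_outer h.u_gt h.v_gt h.w_gt,
    cosineLawAngle_eq_polarAngle hσ]
  obtain ⟨a, ha, rfl⟩ := exists_sq_sub_one h.u_gt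
  obtain ⟨b, hb, rfl⟩ := exists_sq_sub_one h.v_gt
  obtain ⟨c, hc, rfl⟩ := exists_sq_sub_one h.w_gt
  have h2 : √2 * √2 = (2 : ℝ) := Real.mul_self_sqrt (by norm_num)
  refine Eq.trans ?_ (polarAngle_mul (k := 1 / (2 * b * c)) (by positivity) _)
  rw [midline_sq_sub_one b c a hb hc, halfSide_sq_sub_one hb, halfSide_sq_sub_one hc,
    div_mul_div_comm, h2]
  congr 1
  · field_simp
    ring
  · field_simp
    ring

theorem angle_outer_next (hσ : σ = 1 ∨ σ = -1) {u v w : ℝ} (h : IsSides σ u v w) :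
    cosineLawAngle σ (halfSide u) (midline v w u) (halfSide w) =
      polarAngle (σ * (halfSide w * (1 + u - v - w))) (gram u v w) := by
  rw [cosineLawAngle_eq_polarAngle hσ, ← gram_rotate (halfSide u), ← gram_swap (midline v w u)]
  rw [← gram_swap, gram_outer h.v_gt h.w_gt h.u_gt, gram_rotate]
  obtain ⟨a, ha, rfl⟩ := exists_sq_sub_one h.u_gt
  obtain ⟨b, hb, rfl⟩ := exists_sq_sub_one h.v_gt
  obtain ⟨c, hc, rfl⟩ := exists_sq_sub_one h.w_gt
  rw [← polarAngle_mul (k := 1 / (2 * c * a)) (by positivity) (σ * (_ * _))]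
  rw [midline_sq_sub_one c a b hc ha, halfSide_sq_sub_one ha, halfSide_sq_sub_one hc]
  congr 1
  · field_simp
    ring
  · field_simp
    ring

/-! ### Subdivision triangles are non-degenerate -/

theorem midline_bounds (hσ : σ = 1 ∨ σ = -1) {u v w : ℝ} (h : IsSides σ u v w) :
    0 < σ * (1 - midline u v w) ∧ 0 < 1 + midline u v w := by
  obtain ⟨hu, hv, hw, hu', hv', hw', hg⟩ := h
  unfold gram at hg
  have hp : 0 < (1 + v) * (1 + w) := mul_pos hv' hw'
  unfold midline
  set r := √((1 + v) * (1 + w)) with hr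
  have hr0 : 0 < r := Real.sqrt_pos.2 hp
  have hrsq : r ^ 2 = (1 + v) * (1 + w) := Real.sq_sqrt hp.le
  rcases hσ with rfl | rfl
  -- Uses 4(1 + v)(1 + w) - (1 + u + v + w)² = `gram u v w` + 2(1 - u)(1 + v)(1 + w).
  · have key : (1 + u + v + w) ^ 2 < (2 * r) ^ 2 := by
      rw [mul_pow, hrsq]
      have : 0 < (1 - u) * ((1 + v) * (1 + w)) := mul_pos (by linarith) hp
      nlinarith
    have := abs_lt_of_sq_lt_sq' key (by positivity)
    rw [one_mul, sub_pos, div_lt_one (by positivity)]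
    refine ⟨this.2, ?_⟩
    rw [← neg_lt_iff_pos_add', lt_div_iff₀ (by positivity)]
    linarith
  -- Here (1 + u + v + w)² - 4(1 + v)(1 + w) = (u - 1)(u + 2v + 2w + 3) + (v - w)².
  · have key : 2 * r < 1 + u + v + w := by
      apply lt_of_pow_lt_pow_left₀ 2 (by linarith)
      rw [mul_pow, hrsq]
      have h1 : 0 < (u - 1) * (u + 2 * v + 2 * w + 3) := mul_pos (by linarith) (by linarith)
      linarith [sq_nonneg (v - w)]
    have : 1 < (1 + u + v + w) / (2 * r) := by rwa [one_lt_div (by positivity)]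
    constructor <;> linarith

theorem halfSide_bounds (hσ : σ = 1 ∨ σ = -1) {w : ℝ} (h : 0 < σ * (1 - w)) (hw : 0 < 1 + w) :
    0 < σ * (1 - halfSide w) ∧ 0 < 1 + halfSide w := by
  unfold halfSide
  have h0 := Real.sqrt_nonneg ((1 + w) / 2)
  refine ⟨?_, by positivity⟩
  rcases hσ with rfl | rfl
  · have : √((1 + w) / 2) < 1 := by
      rw [Real.sqrt_lt' one_pos]; linarith
    linarith
  · have : 1 < √((1 + w) / 2) := by
      rw [Real.lt_sqrt zero_le_one]; linarith
    linarith

theorem IsSides.inner (hσ : σ = 1 ∨ σ = -1) {u v w : ℝ} (h : IsSides σ u v w) :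
    IsSides σ (midline u v w) (midline v w u) (midline w u v) := by
  have h1 := midline_bounds hσ h
  have h2 := midline_bounds hσ h.rotate
  have h3 := midline_bounds hσ h.rotate.rotate
  refine ⟨h1.1, h2.1, h3.1, h1.2, h2.2, h3.2, ?_⟩
  rw [gram_inner h.u_gt h.v_gt h.w_gt]
  have := h.u_gt
  have := h.v_gt
  have := h.w_gt
  have := h.gram_pos
  positivity

theorem IsSides.outer (hσ : σ = 1 ∨ σ = -1) {u v w : ℝ} (h : IsSides σ u v w) :
    IsSides σ (midline u v w) (halfSide v) (halfSide w) := by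
  have h1 := midline_bounds hσ h
  have h2 := halfSide_bounds hσ h.v_ne h.v_gt
  have h3 := halfSide_bounds hσ h.w_ne h.w_gt
  refine ⟨h1.1, h2.1, h3.1, h1.2, h2.2, h3.2, ?_⟩
  rw [gram_outer h.u_gt h.v_gt h.w_gt]
  have := h.v_gt
  have := h.w_gt
  have := h.gram_pos
  positivity

/-! ### Subdivision triangles are smaller -/

/-- Negative curvature: positivity of the Gram determinant says that the midline is shorter than
half the opposite side, so `midline u v w` is at most √((1 + u) / 2), and this is at most (3 + u) /
4. -/
theorem midline_le_of_neg {u v w : ℝ} (h : IsSides (-1) u v w) :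
    midline u v w - 1 ≤ (u - 1) / 4 := by
  obtain ⟨hu, hv, hw, hu', hv', hw', hg⟩ := h
  unfold gram at hg
  have hp : 0 < (1 + v) * (1 + w) := mul_pos hv' hw'
  unfold midline
  set r := √((1 + v) * (1 + w)) with hr
  have hr0 : 0 < r := Real.sqrt_pos.2 hp
  have hrsq : r ^ 2 = (1 + v) * (1 + w) := Real.sq_sqrt hp.le
  have key : 1 + u + v + w ≤ (3 + u) / 2 * r := by
    apply le_of_sq_le_sq _ (by nlinarith)
    rw [mul_pow, hrsq]
    have h1 : 0 ≤ (u - 1) ^ 2 * ((1 + v) * (1 + w)) := by positivity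
    nlinarith
  rw [sub_le_iff_le_add, div_le_iff₀ (by positivity)]
  linarith

/-- In positive curvature the midline is longer than half the opposite side. For v + w ≥ 0, the
inequality 2√((1 + v)(1 + w)) ≤ 2 + v + w still gives a contraction. -/
theorem one_sub_midline_le {u v w : ℝ} (h : IsSides 1 u v w) (hvw : 0 ≤ v + w) :
    1 - midline u v w ≤ (1 - u) / 2 := by
  obtain ⟨hu, hv, hw, hu', hv', hw', hg⟩ := h
  have hp : 0 < (1 + v) * (1 + w) := mul_pos hv' hw'
  unfold midline
  set r := √((1 + v) * (1 + w)) with hr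
  have hr0 : 0 < r := Real.sqrt_pos.2 hp
  have hrsq : r ^ 2 = (1 + v) * (1 + w) := Real.sq_sqrt hp.le
  have hle : 2 * r ≤ 2 + v + w := by
    apply le_of_sq_le_sq _ (by linarith)
    rw [mul_pow, hrsq]
    nlinarith [sq_nonneg (v - w)]
  rw [sub_le_comm, le_div_iff₀ (by positivity)]
  nlinarith

theorem abs_sqrt_sub_one_le {t : ℝ} (ht : 0 ≤ t) : |√t - 1| ≤ |t - 1| := by
  have h0 := Real.sqrt_nonneg t
  have h1 : t - 1 = (√t - 1) * (√t + 1) := by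
    nlinarith [Real.sq_sqrt ht]
  rw [h1, abs_mul, abs_of_nonneg (by positivity : 0 ≤ √t + 1)]
  nlinarith [abs_nonneg (√t - 1)]

theorem abs_halfSide_sub_one_le {w : ℝ} (hw : 0 < 1 + w) :
    |halfSide w - 1| ≤ |1 - w| / 2 := by
  refine (abs_sqrt_sub_one_le (by positivity)).trans_eq ?_
  rw [show (1 + w) / 2 - 1 = -((1 - w) / 2) by ring, abs_neg, abs_div, abs_two]

theorem abs_one_sub_eq (hσ : σ = 1 ∨ σ = -1) {w : ℝ} (h : 0 < σ * (1 - w)) :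
    |1 - w| = σ * (1 - w) := by
  rcases hσ with rfl | rfl
  · rw [one_mul] at h ⊢; exact abs_of_pos h
  · rw [abs_of_neg (by linarith)]; ring

theorem halfSide_le (hσ : σ = 1 ∨ σ = -1) {w : ℝ} (h : 0 < σ * (1 - w)) (hw : 0 < 1 + w) :
    σ * (1 - halfSide w) ≤ σ * (1 - w) / 2 := by
  rw [← abs_one_sub_eq hσ h, ← abs_one_sub_eq hσ (halfSide_bounds hσ h hw).1, abs_sub_comm]
  exact abs_halfSide_sub_one_le hw

/-! ### The change of the angles -/

theorem abs_angle_sub_le (hσ : σ = 1 ∨ σ = -1) {u v w m p : ℝ} (h : IsSides σ u v w)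
    (hm : σ * (1 - u) + σ * (1 - v) + σ * (1 - w) = m) (hm8 : m ≤ 1 / 8) (hp : |p - 1| ≤ m) :
    |polarAngle (σ * (p * (1 + u - v - w))) (gram u v w) - cosineLawAngle σ u v w| ≤
      Real.pi * (4 * m) * cosineLawAngle σ u v w := by
  have hg := h.gram_pos
  rw [cosineLawAngle_eq_polarAngle hσ]
  apply abs_polarAngle_sub_le hg (by linarith)
  -- N = Y + Z - X in the notation introduced next. Both N and Y Z have to be compared with the
  -- hypotenuse r, which is of order √(Y Z).
  obtain ⟨N, hN⟩ : ∃ N, N = σ * (1 + u - v - w) := ⟨_, rfl⟩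
  obtain ⟨X, hX⟩ : ∃ X, X = σ * (1 - u) := ⟨_, rfl⟩
  obtain ⟨Y, hY⟩ : ∃ Y, Y = σ * (1 - v) := ⟨_, rfl⟩
  obtain ⟨Z, hZ⟩ : ∃ Z, Z = σ * (1 - w) := ⟨_, rfl⟩
  have hX0 : 0 < X := hX ▸ h.u_ne
  have hY0 : 0 < Y := hY ▸ h.v_ne
  have hZ0 : 0 < Z := hZ ▸ h.w_ne
  have hsum : X + Y + Z = m := by rw [hX, hY, hZ]; exact hm
  set r := √((σ * (u - v * w)) ^ 2 + gram u v w) with hr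
  have hr0 : 0 < r := Real.sqrt_pos.2 (by positivity)
  have hrsq : r ^ 2 = Y * Z * ((1 + v) * (1 + w)) := by
    rw [hr, Real.sq_sqrt (by positivity), hY, hZ, gram]
    rcases hσ with rfl | rfl <;> ring
  have hv : 7 / 4 ≤ 1 + v := by rcases hσ with rfl | rfl <;> linarith
  have hw : 7 / 4 ≤ 1 + w := by rcases hσ with rfl | rfl <;> linarith
  have hvw : 3 ≤ (1 + v) * (1 + w) := by nlinarith
  have hYZ : 0 < Y * Z := mul_pos hY0 hZ0
  have hr3 : 3 * (Y * Z) ≤ r ^ 2 := by rw [hrsq]; nlinarith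
  -- Non-degeneracy enters here: a positive Gram determinant bounds N² by 4 Y Z plus a term of
  -- higher order.
  have hN2 : N ^ 2 ≤ 5 * (Y * Z) := by
    have h1 : gram u v w = 4 * (Y * Z) - N ^ 2 - 2 * σ * X * (Y * Z) := by
      rw [hN, hX, hY, hZ, gram]
      rcases hσ with rfl | rfl <;> ring
    have h2 : X * (Y * Z) ≤ 1 / 8 * (Y * Z) := by gcongr; linarith
    have h3 : 0 < X * (Y * Z) := by positivity
    rcases hσ with rfl | rfl <;> linarith
  have hNr : |N| ≤ 3 / 2 * r := by
    apply abs_le_of_sq_le_sq _ (by positivity)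
    nlinarith
  have hYZr : Y * Z ≤ m * r := by
    apply le_of_sq_le_sq _ (by rw [← hsum]; positivity)
    have h1 : Y * Z ≤ m ^ 2 := by nlinarith
    calc (Y * Z) ^ 2 = Y * Z * (Y * Z) := by ring
      _ ≤ m ^ 2 * r ^ 2 := by gcongr; linarith
      _ = (m * r) ^ 2 := by ring
  have hdiff : σ * (p * (1 + u - v - w)) - σ * (u - v * w) = (p - 1) * N + σ * (Y * Z) := by
    rw [hN, hY, hZ]
    rcases hσ with rfl | rfl <;> ring
  rw [hdiff]
  have hσabs : |σ| = 1 := by rcases hσ with rfl | rfl <;> norm_num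
  have hm0 : 0 < m := by rw [← hsum]; positivity
  calc |(p - 1) * N + σ * (Y * Z)| ≤ |(p - 1) * N| + |σ * (Y * Z)| := abs_add_le _ _
    _ = |p - 1| * |N| + Y * Z := by rw [abs_mul, abs_mul, hσabs, one_mul, abs_of_pos hYZ]
    _ ≤ m * (3 / 2 * r) + m * r := by gcongr
    _ ≤ 4 * m * r := by
      have : 0 < m * r := by positivity
      linarith

theorem abs_angle_inner_sub_le (hσ : σ = 1 ∨ σ = -1) {u v w m : ℝ} (h : IsSides σ u v w)
    (hm : σ * (1 - u) + σ * (1 - v) + σ * (1 - w) = m) (hm8 : m ≤ 1 / 8) :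
    |cosineLawAngle σ (midline u v w) (midline v w u) (midline w u v) - cosineLawAngle σ u v w| ≤
      Real.pi * (4 * m) * cosineLawAngle σ u v w := by
  rw [angle_inner hσ h]
  apply abs_angle_sub_le hσ h hm hm8
  have hu := abs_halfSide_sub_one_le h.u_gt
  rw [abs_one_sub_eq hσ h.u_ne] at hu
  have := h.u_ne
  have := h.v_ne
  have := h.w_ne
  have hu' := abs_le.1 hu
  have hpos : 15 / 16 ≤ halfSide u := by linarith
  have hne : halfSide u ≠ 0 := by positivity
  rw [show (1 + u + v + w) / 4 / halfSide u - 1 =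
    ((1 + u + v + w) / 4 - halfSide u) / halfSide u by field_simp, abs_div,
    abs_of_pos (by linarith : 0 < halfSide u), div_le_iff₀ (by linarith)]
  -- The first term is within m/4 of 1, the second within m/2.
  have h1 : |(1 + u + v + w) / 4 - halfSide u| ≤ 3 / 4 * m := by
    rw [abs_le]
    rcases hσ with rfl | rfl <;> constructor <;> linarith
  nlinarith

theorem abs_angle_outer_next_sub_le (hσ : σ = 1 ∨ σ = -1) {u v w m : ℝ} (h : IsSides σ u v w)
    (hm : σ * (1 - u) + σ * (1 - v) + σ * (1 - w) = m) (hm8 : m ≤ 1 / 8) :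
    |cosineLawAngle σ (halfSide u) (midline v w u) (halfSide w) - cosineLawAngle σ u v w| ≤
      Real.pi * (4 * m) * cosineLawAngle σ u v w := by
  rw [angle_outer_next hσ h]
  apply abs_angle_sub_le hσ h hm hm8
  refine (abs_halfSide_sub_one_le h.w_gt).trans ?_
  rw [abs_one_sub_eq hσ h.w_ne]
  have := h.u_ne
  have := h.v_ne
  have := h.w_ne
  linarith

/-- The mirror image of `abs_angle_outer_next_sub_le`. -/
theorem abs_angle_outer_prev_sub_le (hσ : σ = 1 ∨ σ = -1) {u v w m : ℝ} (h : IsSides σ u v w)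
    (hm : σ * (1 - u) + σ * (1 - v) + σ * (1 - w) = m) (hm8 : m ≤ 1 / 8) :
    |cosineLawAngle σ (halfSide u) (halfSide v) (midline w u v) - cosineLawAngle σ u v w| ≤
      Real.pi * (4 * m) * cosineLawAngle σ u v w := by
  rw [← cosineLawAngle_swap, ← midline_swap, ← cosineLawAngle_swap σ u v w]
  exact abs_angle_outer_next_sub_le hσ h.swap (by linarith) hm8

end

/-! ### Triangles given by their vertices in `ℝ³` -/

/-- The form on `ℝ³` whose unit vectors are the points of the sphere if `σ = 1`, and of the
hyperboloid if `σ = -1`. -/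
def form (σ : ℝ) (x y : Fin 3 → ℝ) : ℝ := x 2 * y 2 + σ * (x 0 * y 0 + x 1 * y 1)

/-- The midpoint of two points. -/
def mid (σ : ℝ) (x y : Fin 3 → ℝ) : Fin 3 → ℝ := (√(2 * (1 + form σ x y)))⁻¹ • (x + y)

/-- The (hyperbolic) cosine of the side opposite to the vertex `i`. -/
def sideCos (σ : ℝ) (t : Fin 3 → Fin 3 → ℝ) (i : Fin 3) : ℝ := form σ (t (i + 1)) (t (i + 2))

/-- The four triangles of the medial subdivision: the inner one, and the outer ones at the three
vertices. -/
def subdiv (σ : ℝ) : Option (Fin 3) → (Fin 3 → Fin 3 → ℝ) → Fin 3 → Fin 3 → ℝ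
  | none, t => fun i => mid σ (t (i + 1)) (t (i + 2))
  | some k, t => fun i => if i = k then t k else mid σ (t k) (t i)

/-- The vertices of a non-degenerate triangle. -/
structure IsTri (σ : ℝ) (t : Fin 3 → Fin 3 → ℝ) : Prop where
  unit : ∀ i, form σ (t i) (t i) = 1
  isSides_zero : IsSides σ (sideCos σ t 0) (sideCos σ t 1) (sideCos σ t 2)

/-- The angle at the vertex `i`. -/
def triAngle (σ : ℝ) (i : Fin 3) (t : Fin 3 → Fin 3 → ℝ) : ℝ :=
  cosineLawAngle σ (sideCos σ t i) (sideCos σ t (i + 1)) (sideCos σ t (i + 2))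

/-- A measure of the size of a triangle. -/
def triSize (σ : ℝ) (t : Fin 3 → Fin 3 → ℝ) : ℝ :=
  σ * (1 - sideCos σ t 0) + σ * (1 - sideCos σ t 1) + σ * (1 - sideCos σ t 2)

theorem fin3_add_one_one : ∀ i : Fin 3, i + 1 + 1 = i + 2 := by decide
theorem fin3_add_one_two : ∀ i : Fin 3, i + 1 + 2 = i := by decide
theorem fin3_add_two_one : ∀ i : Fin 3, i + 2 + 1 = i := by decide
theorem fin3_add_two_two : ∀ i : Fin 3, i + 2 + 2 = i + 1 := by decide
theorem fin3_add_one_ne : ∀ i : Fin 3, i + 1 ≠ i := by decide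
theorem fin3_add_two_ne : ∀ i : Fin 3, i + 2 ≠ i := by decide
theorem fin3_add_one_ne_add_two : ∀ i : Fin 3, i + 1 ≠ i + 2 := by decide
theorem fin3_cases : ∀ i j : Fin 3, j = i ∨ j = i + 1 ∨ j = i + 2 := by decide

theorem form_comm (σ : ℝ) (x y : Fin 3 → ℝ) : form σ x y = form σ y x := by unfold form; ring

theorem form_smul_add_smul_add (σ a b : ℝ) (x y z w : Fin 3 → ℝ) :
    form σ (a • (x + y)) (b • (z + w)) =
      a * b * (form σ x z + form σ x w + form σ y z + form σ y w) := by
  simp only [form, Pi.smul_apply, Pi.add_apply, smul_eq_mul]; ring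

theorem form_smul_add_right (σ b : ℝ) (x z w : Fin 3 → ℝ) :
    form σ x (b • (z + w)) = b * (form σ x z + form σ x w) := by
  simp only [form, Pi.smul_apply, Pi.add_apply, smul_eq_mul]; ring

theorem mid_comm (σ : ℝ) (x y : Fin 3 → ℝ) : mid σ x y = mid σ y x := by
  unfold mid; rw [form_comm, add_comm x y]

/-! ### Midpoints as normalised sums -/

section

variable {σ : ℝ} {x y z : Fin 3 → ℝ}

theorem form_mid_mid (hx : form σ x x = 1) (hxy : 0 < 1 + form σ x y) :
    form σ (mid σ x y) (mid σ x z) = midline (form σ y z) (form σ x y) (form σ x z) := by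
  rw [mid, mid, form_smul_add_smul_add, hx, form_comm σ y x, midline, ← mul_inv,
    ← Real.sqrt_mul (by positivity), show 2 * (1 + form σ x y) * (2 * (1 + form σ x z)) =
      2 ^ 2 * ((1 + form σ x y) * (1 + form σ x z)) by ring, Real.sqrt_mul (by positivity),
    Real.sqrt_sq (by norm_num), inv_mul_eq_div]
  ring

theorem form_mid_left (hx : form σ x x = 1) (hxy : 0 < 1 + form σ x y) :
    form σ x (mid σ x y) = halfSide (form σ x y) := by
  have hr : √(2 * (1 + form σ x y)) = 2 * √((1 + form σ x y) / 2) := by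
    rw [show 2 * (1 + form σ x y) = 2 ^ 2 * ((1 + form σ x y) / 2) by ring,
      Real.sqrt_mul (by positivity), Real.sqrt_sq (by norm_num)]
  have h0 : 0 < √((1 + form σ x y) / 2) := Real.sqrt_pos.2 (by positivity)
  have hsq : √((1 + form σ x y) / 2) ^ 2 = (1 + form σ x y) / 2 := Real.sq_sqrt (by positivity)
  rw [mid, form_smul_add_right, hx, hr, halfSide, inv_mul_eq_div, div_eq_iff (by positivity)]
  linarith

theorem form_mid_self (hx : form σ x x = 1) (hy : form σ y y = 1) (hxy : 0 < 1 + form σ x y) :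
    form σ (mid σ x y) (mid σ x y) = 1 := by
  rw [mid, form_smul_add_smul_add, hx, hy, form_comm σ y x, ← mul_inv,
    Real.mul_self_sqrt (by positivity), inv_mul_eq_div, div_eq_one_iff_eq (by positivity)]
  ring

/-- Two points with scalar product `1` coincide. -/
theorem eq_of_form_eq_one (hσ : σ = 1 ∨ σ = -1) (hx : form σ x x = 1) (hy : form σ y y = 1)
    (hxy : form σ x y = 1) : x = y := by
  unfold form at hx hy hxy
  rcases hσ with rfl | rfl
  · have h : (x 0 - y 0) ^ 2 + (x 1 - y 1) ^ 2 + (x 2 - y 2) ^ 2 = 0 := by linarith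
    have h0 : x 0 - y 0 = 0 := by nlinarith [sq_nonneg (x 1 - y 1), sq_nonneg (x 2 - y 2)]
    have h1 : x 1 - y 1 = 0 := by nlinarith [sq_nonneg (x 0 - y 0), sq_nonneg (x 2 - y 2)]
    have h2 : x 2 - y 2 = 0 := by nlinarith [sq_nonneg (x 1 - y 1), sq_nonneg (x 0 - y 0)]
    ext i; fin_cases i <;> simp <;> linarith
  -- The difference x - y is isotropic and Lorentz-orthogonal to the timelike vector x, hence zero;
  -- `e4` is Lagrange's identity for the first two coordinates.
  · obtain ⟨a, ha⟩ : ∃ a, a = x 0 - y 0 := ⟨_, rfl⟩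
    obtain ⟨b, hb⟩ : ∃ b, b = x 1 - y 1 := ⟨_, rfl⟩
    obtain ⟨c, hc⟩ : ∃ c, c = x 2 - y 2 := ⟨_, rfl⟩
    have e1 : c ^ 2 = a ^ 2 + b ^ 2 := by rw [ha, hb, hc]; linarith
    have e2 : c * x 2 = a * x 0 + b * x 1 := by rw [ha, hb, hc]; linarith
    have e3 : x 2 ^ 2 = 1 + x 0 ^ 2 + x 1 ^ 2 := by linarith
    have e4 : c ^ 2 * x 2 ^ 2 + (a * x 1 - b * x 0) ^ 2 = c ^ 2 * (x 2 ^ 2 - 1) := by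
      rw [show c ^ 2 * x 2 ^ 2 = (c * x 2) ^ 2 by ring, e2, e3, e1]; ring
    have hc0 : c ^ 2 = 0 := by nlinarith [sq_nonneg (a * x 1 - b * x 0), sq_nonneg c]
    have hc1 : c = 0 := by simpa using hc0
    have ha1 : a = 0 := by nlinarith [sq_nonneg a, sq_nonneg b]
    have hb1 : b = 0 := by nlinarith [sq_nonneg a, sq_nonneg b]
    ext i; fin_cases i <;> simp <;> linarith

/-- By linearity z has scalar product 1 with the normalised sum, so the two unit vectors coincide.
-/
theorem eq_mid (hσ : σ = 1 ∨ σ = -1) (hx : form σ x x = 1) (hy : form σ y y = 1)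
    (hz : form σ z z = 1) (hxy : 0 < 1 + form σ x y) (h1 : form σ x z = halfSide (form σ x y))
    (h2 : form σ z y = halfSide (form σ x y)) : z = mid σ x y := by
  apply eq_of_form_eq_one hσ hz (form_mid_self hx hy hxy)
  have h3 := form_mid_self hx hy hxy
  have h4 : form σ y (mid σ x y) = halfSide (form σ x y) := by
    rw [mid_comm, form_mid_left hy (by rwa [form_comm]), form_comm]
  rw [← h3]
  conv_lhs => rw [mid]
  conv_rhs => rw [show form σ (mid σ x y) (mid σ x y) =
    form σ (mid σ x y) ((√(2 * (1 + form σ x y)))⁻¹ • (x + y)) from rfl]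
  rw [form_smul_add_right, form_smul_add_right, form_comm σ z x, h1, h2,
    form_comm σ (mid σ x y) x, form_comm σ (mid σ x y) y, h4, form_mid_left hx hxy]

end

/-! ### Sides and angles of the subdivided vector triangles -/

section

variable {σ : ℝ} {t : Fin 3 → Fin 3 → ℝ}

theorem IsTri.isSides (h : IsTri σ t) (i : Fin 3) :
    IsSides σ (sideCos σ t i) (sideCos σ t (i + 1)) (sideCos σ t (i + 2)) := by
  have h0 := h.isSides_zero
  fin_cases i
  · exact h0
  · exact h0.rotate
  · exact h0.rotate.rotate

theorem form_self_next (σ : ℝ) (t : Fin 3 → Fin 3 → ℝ) (i : Fin 3) :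
    form σ (t i) (t (i + 1)) = sideCos σ t (i + 2) := by
  rw [sideCos, fin3_add_two_one, fin3_add_two_two]

theorem form_self_prev (σ : ℝ) (t : Fin 3 → Fin 3 → ℝ) (i : Fin 3) :
    form σ (t i) (t (i + 2)) = sideCos σ t (i + 1) := by
  rw [sideCos, fin3_add_one_one, fin3_add_one_two, form_comm]

theorem triSize_eq (σ : ℝ) (t : Fin 3 → Fin 3 → ℝ) (i : Fin 3) :
    σ * (1 - sideCos σ t i) + σ * (1 - sideCos σ t (i + 1)) + σ * (1 - sideCos σ t (i + 2)) =
      triSize σ t := by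
  fin_cases i
  · rfl
  · show σ * (1 - sideCos σ t 1) + σ * (1 - sideCos σ t 2) + σ * (1 - sideCos σ t 0) = _
    unfold triSize; ring
  · show σ * (1 - sideCos σ t 2) + σ * (1 - sideCos σ t 0) + σ * (1 - sideCos σ t 1) = _
    unfold triSize; ring

theorem IsTri.one_add_next_pos (h : IsTri σ t) (i : Fin 3) : 0 < 1 + form σ (t i) (t (i + 1)) := by
  rw [form_self_next]; exact (h.isSides i).w_gt

theorem IsTri.one_add_prev_pos (h : IsTri σ t) (i : Fin 3) : 0 < 1 + form σ (t i) (t (i + 2)) := by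
  rw [form_self_prev]; exact (h.isSides i).v_gt

theorem IsTri.one_add_pos (h : IsTri σ t) {i j : Fin 3} (hij : j ≠ i) :
    0 < 1 + form σ (t i) (t j) := by
  rcases fin3_cases i j with rfl | rfl | rfl
  · exact absurd rfl hij
  · exact h.one_add_next_pos _
  · exact h.one_add_prev_pos _

theorem subdiv_some_self (σ : ℝ) (t : Fin 3 → Fin 3 → ℝ) (k : Fin 3) :
    subdiv σ (some k) t k = t k := if_pos rfl

theorem subdiv_some_next (σ : ℝ) (t : Fin 3 → Fin 3 → ℝ) (k : Fin 3) :
    subdiv σ (some k) t (k + 1) = mid σ (t k) (t (k + 1)) := if_neg (fin3_add_one_ne k)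

theorem subdiv_some_prev (σ : ℝ) (t : Fin 3 → Fin 3 → ℝ) (k : Fin 3) :
    subdiv σ (some k) t (k + 2) = mid σ (t k) (t (k + 2)) := if_neg (fin3_add_two_ne k)

theorem subdiv_none_next (σ : ℝ) (t : Fin 3 → Fin 3 → ℝ) (k : Fin 3) :
    subdiv σ none t (k + 1) = mid σ (t k) (t (k + 2)) := by
  rw [mid_comm]
  show mid σ _ _ = _
  rw [fin3_add_one_one, fin3_add_one_two]

theorem subdiv_none_prev (σ : ℝ) (t : Fin 3 → Fin 3 → ℝ) (k : Fin 3) :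
    subdiv σ none t (k + 2) = mid σ (t k) (t (k + 1)) := by
  show mid σ _ _ = _
  rw [fin3_add_two_one, fin3_add_two_two]

theorem IsTri.sideCos_inner (h : IsTri σ t) (i : Fin 3) : sideCos σ (subdiv σ none t) i =
    midline (sideCos σ t i) (sideCos σ t (i + 1)) (sideCos σ t (i + 2)) := by
  rw [sideCos, subdiv_none_next, subdiv_none_prev,
    form_mid_mid (h.unit i) (h.one_add_prev_pos i), form_self_next,
    form_self_prev, form_comm]
  rfl

theorem IsTri.sideCos_outer_self (h : IsTri σ t) (k : Fin 3) :
    sideCos σ (subdiv σ (some k) t) k =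
      midline (sideCos σ t k) (sideCos σ t (k + 1)) (sideCos σ t (k + 2)) := by
  rw [sideCos, subdiv_some_next, subdiv_some_prev,
    form_mid_mid (h.unit k) (h.one_add_next_pos k), form_self_next,
    form_self_prev, midline_swap]
  rfl

theorem IsTri.sideCos_outer_next (h : IsTri σ t) (k : Fin 3) :
    sideCos σ (subdiv σ (some k) t) (k + 1) = halfSide (sideCos σ t (k + 1)) := by
  rw [← form_self_prev, subdiv_some_self, subdiv_some_prev,
    form_mid_left (h.unit k) (h.one_add_prev_pos k), form_self_prev]

theorem IsTri.sideCos_outer_prev (h : IsTri σ t) (k : Fin 3) :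
    sideCos σ (subdiv σ (some k) t) (k + 2) = halfSide (sideCos σ t (k + 2)) := by
  rw [← form_self_next, subdiv_some_self, subdiv_some_next,
    form_mid_left (h.unit k) (h.one_add_next_pos k), form_self_next]

theorem IsTri.of_isSides (hu : ∀ i, form σ (t i) (t i) = 1) (i : Fin 3)
    (h : IsSides σ (sideCos σ t i) (sideCos σ t (i + 1)) (sideCos σ t (i + 2))) : IsTri σ t := by
  refine ⟨hu, ?_⟩
  fin_cases i
  · exact h
  · exact h.rotate.rotate
  · exact h.rotate

theorem IsTri.subdiv (hσ : σ = 1 ∨ σ = -1) (h : IsTri σ t) (k : Option (Fin 3)) :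
    IsTri σ (subdiv σ k t) := by
  cases k with
  | none =>
    apply IsTri.of_isSides (i := 0)
    · intro i
      refine form_mid_self (h.unit _) (h.unit _) ?_
      exact (h.isSides i).u_gt
    · rw [h.sideCos_inner, h.sideCos_inner, h.sideCos_inner]
      exact (h.isSides 0).inner hσ
  | some k =>
    apply IsTri.of_isSides (i := k)
    · intro i
      rcases fin3_cases k i with rfl | rfl | rfl
      · rw [subdiv_some_self]; exact h.unit _
      · rw [subdiv_some_next]; exact form_mid_self (h.unit _) (h.unit _) (h.one_add_next_pos _)
      · rw [subdiv_some_prev]; exact form_mid_self (h.unit _) (h.unit _) (h.one_add_prev_pos _)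
    · rw [h.sideCos_outer_self, h.sideCos_outer_next, h.sideCos_outer_prev]
      exact (h.isSides k).outer hσ

theorem IsTri.triAngle_pos (hσ : σ = 1 ∨ σ = -1) (h : IsTri σ t) (i : Fin 3) :
    0 < triAngle σ i t := (h.isSides i).cosineLawAngle_pos hσ

theorem IsTri.triSize_pos (h : IsTri σ t) : 0 < triSize σ t :=
  add_pos (add_pos h.isSides_zero.u_ne h.isSides_zero.v_ne) h.isSides_zero.w_ne

theorem IsTri.abs_triAngle_sub_le (hσ : σ = 1 ∨ σ = -1) (h : IsTri σ t) (i : Fin 3)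
    (k : Option (Fin 3)) (hs : triSize σ t ≤ 1 / 8) :
    |triAngle σ i (MedialSubdivision.subdiv σ k t) - triAngle σ i t| ≤
      Real.pi * 4 * triSize σ t * triAngle σ i t := by
  have hi := h.isSides i
  rw [mul_assoc Real.pi]
  cases k with
  | none =>
    unfold triAngle
    rw [h.sideCos_inner, h.sideCos_inner, h.sideCos_inner, fin3_add_one_one, fin3_add_one_two,
      fin3_add_two_one, fin3_add_two_two]
    exact abs_angle_inner_sub_le hσ hi (triSize_eq σ t i) hs
  | some k =>
    rcases fin3_cases i k with rfl | rfl | rfl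
    · unfold triAngle
      rw [h.sideCos_outer_self, h.sideCos_outer_next, h.sideCos_outer_prev, angle_outer_self hσ hi,
        sub_self, abs_zero]
      have := h.triSize_pos
      have := hi.cosineLawAngle_pos hσ
      positivity
    · have h1 := h.sideCos_outer_self (i + 1)
      have h2 := h.sideCos_outer_next (i + 1)
      have h3 := h.sideCos_outer_prev (i + 1)
      simp only [fin3_add_one_one, fin3_add_one_two] at h1 h2 h3
      unfold triAngle
      rw [h1, h2, h3]
      exact abs_angle_outer_next_sub_le hσ hi (triSize_eq σ t i) hs
    · have h1 := h.sideCos_outer_self (i + 2)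
      have h2 := h.sideCos_outer_next (i + 2)
      have h3 := h.sideCos_outer_prev (i + 2)
      simp only [fin3_add_two_one, fin3_add_two_two] at h1 h2 h3
      unfold triAngle
      rw [h1, h2, h3]
      exact abs_angle_outer_prev_sub_le hσ hi (triSize_eq σ t i) hs

theorem IsTri.triSize_subdiv_le (hσ : σ = 1 ∨ σ = -1) (h : IsTri σ t)
    (hmid : ∀ i, σ * (1 - midline (sideCos σ t i) (sideCos σ t (i + 1)) (sideCos σ t (i + 2))) ≤
      σ * (1 - sideCos σ t i) / 2) (k : Option (Fin 3)) :
    triSize σ (MedialSubdivision.subdiv σ k t) ≤ triSize σ t / 2 := by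
  cases k with
  | none =>
    rw [triSize, h.sideCos_inner, h.sideCos_inner, h.sideCos_inner, triSize]
    linarith [hmid 0, hmid 1, hmid 2]
  | some k =>
    rw [← triSize_eq _ _ k, h.sideCos_outer_self, h.sideCos_outer_next, h.sideCos_outer_prev,
      ← triSize_eq _ _ k]
    have hk := h.isSides k
    linarith [hmid k, halfSide_le hσ hk.v_ne hk.v_gt, halfSide_le hσ hk.w_ne hk.w_gt]

theorem triSize_subdiv_le_of_neg {t : Fin 3 → Fin 3 → ℝ} (h : IsTri (-1) t)
    (k : Option (Fin 3)) : triSize (-1) (subdiv (-1) k t) ≤ triSize (-1) t / 2 := by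
  refine h.triSize_subdiv_le (Or.inr rfl) (fun i => ?_) k
  have := midline_le_of_neg (h.isSides i)
  have := (h.isSides i).u_ne
  linarith

theorem triSize_subdiv_le_of_pos {t : Fin 3 → Fin 3 → ℝ} (h : IsTri 1 t) (hs : triSize 1 t ≤ 1)
    (k : Option (Fin 3)) : triSize 1 (subdiv 1 k t) ≤ triSize 1 t / 2 := by
  refine h.triSize_subdiv_le (Or.inl rfl) (fun i => ?_) k
  rw [← triSize_eq 1 t i] at hs
  have hi := h.isSides i
  rw [one_mul, one_mul]
  apply one_sub_midline_le hi
  linarith [hi.u_ne]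

end

/-! ### Subdivision triangles become small -/

theorem IsOrbit.isTri {σ : ℝ} (hσ : σ = 1 ∨ σ = -1) {s : ℕ → Fin 3 → Fin 3 → ℝ}
    (hs : IsOrbit (subdiv σ) s) (h0 : IsTri σ (s 0)) (n : ℕ) : IsTri σ (s n) := by
  induction n with
  | zero => exact h0
  | succ n ih => obtain ⟨k, hk⟩ := hs n; rw [hk]; exact ih.subdiv hσ k

theorem eventually_small_of_neg {t : Fin 3 → Fin 3 → ℝ} (h : IsTri (-1) t) {δ : ℝ} (hδ : 0 < δ) :
    ∃ N, ∀ s, IsOrbit (subdiv (-1)) s → s 0 = t → triSize (-1) (s N) ≤ δ := by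
  obtain ⟨N, hN⟩ := exists_pow_lt_of_lt_one (div_pos hδ h.triSize_pos)
    (by norm_num : (1 / 2 : ℝ) < 1)
  refine ⟨N, ?_⟩
  rintro s hs rfl
  have key : ∀ n, triSize (-1) (s n) ≤ (1 / 2) ^ n * triSize (-1) (s 0) := by
    intro n
    induction n with
    | zero => simp
    | succ n ih =>
      obtain ⟨k, hk⟩ := hs n
      have := triSize_subdiv_le_of_neg (hs.isTri (Or.inr rfl) h n) k
      rw [hk, pow_succ]
      linarith
  exact (key N).trans ((lt_div_iff₀ h.triSize_pos).1 hN).le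

/-! ### Contraction on the sphere by gnomonic projection -/

theorem norm_smul_sub_smul_le {E : Type*} [NormedAddCommGroup E] [NormedSpace ℝ E] {p q : E}
    {d e f ρ : ℝ} (hp : ‖p‖ ≤ d) (hq : ‖q‖ ≤ d) (hpq : ‖p - q‖ ≤ d) (he : 0 ≤ e) (hf : 0 ≤ f)
    (heρ : e ≤ ρ) (hfρ : f ≤ ρ) : ‖e • p - f • q‖ ≤ ρ * d := by
  have hd : 0 ≤ d := (norm_nonneg _).trans hp
  rcases le_total e f with h | h
  · have : e • p - f • q = e • (p - q) - (f - e) • q := by module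
    rw [this]
    calc ‖e • (p - q) - (f - e) • q‖ ≤ ‖e • (p - q)‖ + ‖(f - e) • q‖ := norm_sub_le _ _
      _ = e * ‖p - q‖ + (f - e) * ‖q‖ := by
        rw [norm_smul, norm_smul, Real.norm_of_nonneg he, Real.norm_of_nonneg (sub_nonneg.2 h)]
      _ ≤ e * d + (f - e) * d := by
        have := sub_nonneg.2 h
        gcongr
      _ = f * d := by ring
      _ ≤ ρ * d := by gcongr
  · have : e • p - f • q = (e - f) • p + f • (p - q) := by module
    rw [this]
    calc ‖(e - f) • p + f • (p - q)‖ ≤ ‖(e - f) • p‖ + ‖f • (p - q)‖ := norm_add_le _ _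
      _ = (e - f) * ‖p‖ + f * ‖p - q‖ := by
        rw [norm_smul, norm_smul, Real.norm_of_nonneg hf, Real.norm_of_nonneg (sub_nonneg.2 h)]
      _ ≤ (e - f) * d + f * d := by
        have := sub_nonneg.2 h
        gcongr
      _ = e * d := by ring
      _ ≤ ρ * d := by gcongr

/-- The gnomonic projection to the plane `c ⬝ᵥ x = 1`. -/
def gnomonic (c x : Fin 3 → ℝ) : Fin 3 → ℝ := (c ⬝ᵥ x)⁻¹ • x

section

variable {c x y z : Fin 3 → ℝ} {H d : ℝ}

theorem dotProduct_mid (c x y : Fin 3 → ℝ) :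
    c ⬝ᵥ mid 1 x y = (√(2 * (1 + form 1 x y)))⁻¹ * (c ⬝ᵥ x + c ⬝ᵥ y) := by
  rw [mid, dotProduct_smul, dotProduct_add, smul_eq_mul]

theorem form_le_one (hx : form 1 x x = 1) (hy : form 1 y y = 1) : form 1 x y ≤ 1 := by
  unfold form at *
  nlinarith [sq_nonneg (x 0 - y 0), sq_nonneg (x 1 - y 1), sq_nonneg (x 2 - y 2)]

/-- Normalising x + y divides it by at most 2, so the midpoint stays on the far side of the plane c
⬝ᵥ x = 1. -/
theorem one_le_dotProduct_mid (hx : form 1 x x = 1) (hy : form 1 y y = 1)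
    (hxy : 0 < 1 + form 1 x y) (hcx : 1 ≤ c ⬝ᵥ x) (hcy : 1 ≤ c ⬝ᵥ y) : 1 ≤ c ⬝ᵥ mid 1 x y := by
  have h := form_le_one hx hy
  have hr : 0 < √(2 * (1 + form 1 x y)) := Real.sqrt_pos.2 (by positivity)
  have hr2 : √(2 * (1 + form 1 x y)) ≤ 2 := Real.sqrt_le_iff.2 ⟨by norm_num, by linarith⟩
  rw [dotProduct_mid, inv_mul_eq_div, le_div_iff₀ hr]
  linarith

/-- Central projection sends geodesics to straight lines; the midpoint goes to a weighted mean of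
the projected ends. With all heights in [1, H] each weight is at most H / (1 + H), a contraction
factor below 1. -/
theorem gnomonic_mid (hxy : 0 < 1 + form 1 x y) (hcx : 1 ≤ c ⬝ᵥ x) (hcy : 1 ≤ c ⬝ᵥ y) :
    gnomonic c (mid 1 x y) =
      gnomonic c x + (c ⬝ᵥ y / (c ⬝ᵥ x + c ⬝ᵥ y)) • (gnomonic c y - gnomonic c x) := by
  have hr : 0 < √(2 * (1 + form 1 x y)) := Real.sqrt_pos.2 (by positivity)
  ext i
  simp only [gnomonic, dotProduct_mid]
  simp only [mid, Pi.smul_apply, Pi.add_apply, Pi.sub_apply, smul_eq_mul]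
  have h1 : c ⬝ᵥ x ≠ 0 := by positivity
  have h2 : c ⬝ᵥ y ≠ 0 := by positivity
  have h3 : c ⬝ᵥ x + c ⬝ᵥ y ≠ 0 := by positivity
  field_simp
  ring

theorem weight_bounds (hcx : 1 ≤ c ⬝ᵥ x) (hcy : 1 ≤ c ⬝ᵥ y) (hcy' : c ⬝ᵥ y ≤ H) :
    0 ≤ c ⬝ᵥ y / (c ⬝ᵥ x + c ⬝ᵥ y) ∧ c ⬝ᵥ y / (c ⬝ᵥ x + c ⬝ᵥ y) ≤ H / (1 + H) := by
  refine ⟨by positivity, ?_⟩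
  rw [div_le_div_iff₀ (by positivity) (by linarith)]
  nlinarith

theorem norm_gnomonic_mid_sub_le (hxy : 0 < 1 + form 1 x y) (hxz : 0 < 1 + form 1 x z)
    (hcx : 1 ≤ c ⬝ᵥ x) (hcy : 1 ≤ c ⬝ᵥ y) (hcz : 1 ≤ c ⬝ᵥ z) (hcy' : c ⬝ᵥ y ≤ H)
    (hcz' : c ⬝ᵥ z ≤ H) (h1 : ‖gnomonic c y - gnomonic c x‖ ≤ d)
    (h2 : ‖gnomonic c z - gnomonic c x‖ ≤ d) (h3 : ‖gnomonic c y - gnomonic c z‖ ≤ d) :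
    ‖gnomonic c (mid 1 x y) - gnomonic c (mid 1 x z)‖ ≤ H / (1 + H) * d := by
  have hy := weight_bounds hcx hcy hcy'
  have hz := weight_bounds hcx hcz hcz'
  rw [gnomonic_mid hxy hcx hcy, gnomonic_mid hxz hcx hcz, add_sub_add_left_eq_sub]
  exact norm_smul_sub_smul_le h1 h2 (by simpa using h3) hy.1 hz.1 hy.2 hz.2

theorem norm_gnomonic_mid_sub_left_le (hxy : 0 < 1 + form 1 x y)
    (hcx : 1 ≤ c ⬝ᵥ x) (hcy : 1 ≤ c ⬝ᵥ y) (hcy' : c ⬝ᵥ y ≤ H)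
    (h1 : ‖gnomonic c y - gnomonic c x‖ ≤ d) :
    ‖gnomonic c (mid 1 x y) - gnomonic c x‖ ≤ H / (1 + H) * d := by
  have hy := weight_bounds hcx hcy hcy'
  rw [gnomonic_mid hxy hcx hcy, add_sub_cancel_left, norm_smul, Real.norm_of_nonneg hy.1]
  exact mul_le_mul hy.2 h1 (norm_nonneg _) (hy.1.trans hy.2)

theorem dotProduct_le_of_form_eq_one (c : Fin 3 → ℝ) (hx : form 1 x x = 1) :
    c ⬝ᵥ x ≤ |c 0| + |c 1| + |c 2| := by
  have key : ∀ i, c i * x i ≤ |c i| := by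
    intro i
    have h : |x i| ≤ 1 := by
      apply abs_le_one_iff_mul_self_le_one.2
      unfold form at hx
      fin_cases i <;> simp <;>
        nlinarith [mul_self_nonneg (x 0), mul_self_nonneg (x 1), mul_self_nonneg (x 2)]
    calc c i * x i ≤ |c i * x i| := le_abs_self _
      _ = |c i| * |x i| := abs_mul _ _
      _ ≤ |c i| := mul_le_of_le_one_right (abs_nonneg _) h
  rw [dotProduct, Fin.sum_univ_three]
  linarith [key 0, key 1, key 2]

/-- With a, b the inverse heights, (a - b)² + 2ab(1 - ⟨x, y⟩) = |ax - by|² ≤ 3d² (the norm is the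
sup norm) and ab ≥ H⁻². -/
theorem one_sub_form_le (hx : form 1 x x = 1) (hy : form 1 y y = 1) (hcx : 1 ≤ c ⬝ᵥ x)
    (hcy : 1 ≤ c ⬝ᵥ y) (hcx' : c ⬝ᵥ x ≤ H) (hcy' : c ⬝ᵥ y ≤ H)
    (hd : ‖gnomonic c x - gnomonic c y‖ ≤ d) : 1 - form 1 x y ≤ 2 * H ^ 2 * d ^ 2 := by
  have key : ∀ i, ((c ⬝ᵥ x)⁻¹ * x i - (c ⬝ᵥ y)⁻¹ * y i) ^ 2 ≤ d ^ 2 := by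
    intro i
    have h := (norm_le_pi_norm (gnomonic c x - gnomonic c y) i).trans hd
    exact sq_le_sq' (abs_le.1 h).1 (abs_le.1 h).2
  have h0 : 0 < c ⬝ᵥ x := by linarith
  have h0' : 0 < c ⬝ᵥ y := by linarith
  obtain ⟨a, ha⟩ : ∃ a, a = (c ⬝ᵥ x)⁻¹ := ⟨_, rfl⟩
  obtain ⟨b, hb⟩ : ∃ b, b = (c ⬝ᵥ y)⁻¹ := ⟨_, rfl⟩
  have ha0 : 0 < a := by rw [ha]; positivity
  have hb0 : 0 < b := by rw [hb]; positivity
  have haH : 1 ≤ H * a := by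
    rw [ha, ← div_eq_mul_inv, one_le_div h0]; exact hcx'
  have hbH : 1 ≤ H * b := by
    rw [hb, ← div_eq_mul_inv, one_le_div h0']; exact hcy'
  have hab : 1 ≤ H ^ 2 * (a * b) := by nlinarith
  rw [← ha, ← hb] at key
  have hle := form_le_one hx hy
  have hsum : 2 * (a * b) * (1 - form 1 x y) ≤ 3 * d ^ 2 := by
    have h : (a - b) ^ 2 + 2 * (a * b) * (1 - form 1 x y) =
        (a * x 0 - b * y 0) ^ 2 + (a * x 1 - b * y 1) ^ 2 + (a * x 2 - b * y 2) ^ 2 := by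
      unfold form at *
      linear_combination (-a ^ 2) * hx - b ^ 2 * hy
    linarith [key 0, key 1, key 2, sq_nonneg (a - b)]
  have h1 : 1 * (1 - form 1 x y) ≤ H ^ 2 * (a * b) * (1 - form 1 x y) := by
    gcongr
  nlinarith [sq_nonneg H, sq_nonneg d]

end

/-- The Gram matrix is T J Tᵀ, where the rows of T are the vertices and J = diag(σ, σ, 1) has
determinant σ². -/
theorem gram_sideCos {σ : ℝ} (hσ2 : σ ^ 2 = 1) {t : Fin 3 → Fin 3 → ℝ}
    (hu : ∀ i, form σ (t i) (t i) = 1) :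
    gram (sideCos σ t 0) (sideCos σ t 1) (sideCos σ t 2) = (Matrix.of t).det ^ 2 := by
  have h : form σ (t 0) (t 0) * form σ (t 1) (t 1) * form σ (t 2) (t 2) +
      2 * form σ (t 1) (t 2) * form σ (t 2) (t 0) * form σ (t 0) (t 1) -
      form σ (t 0) (t 0) * form σ (t 1) (t 2) ^ 2 - form σ (t 1) (t 1) * form σ (t 2) (t 0) ^ 2 -
      form σ (t 2) (t 2) * form σ (t 0) (t 1) ^ 2 = σ ^ 2 * (Matrix.of t).det ^ 2 := by
    rw [Matrix.det_fin_three]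
    simp only [form, Matrix.of_apply]
    ring
  rw [hu, hu, hu, hσ2] at h
  rw [← one_mul ((Matrix.of t).det ^ 2), ← h]
  simp only [gram, sideCos, Fin.isValue]
  norm_num [show (1 : Fin 3) + 1 = 2 from rfl, show (1 : Fin 3) + 2 = 0 from rfl,
    show (2 : Fin 3) + 1 = 0 from rfl, show (2 : Fin 3) + 2 = 1 from rfl]

theorem eventually_small_of_pos {t : Fin 3 → Fin 3 → ℝ} (h : IsTri 1 t) {δ : ℝ} (hδ : 0 < δ) :
    ∃ N, ∀ s, IsOrbit (subdiv 1) s → s 0 = t → triSize 1 (s N) ≤ δ := by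
  have hdet : (Matrix.of t).det ≠ 0 := by
    have := h.isSides_zero.gram_pos
    rw [gram_sideCos (by norm_num) h.unit] at this
    exact fun h0 => by simp [h0] at this
  -- The plane c ⬝ᵥ x = 1 passes through the three vertices; it exists since they are linearly
  -- independent.
  obtain ⟨c, hc⟩ : ∃ c, ∀ i, c ⬝ᵥ t i = 1 := by
    refine ⟨((Matrix.of t)⁻¹).mulVec 1, fun i => ?_⟩
    have h1 : (Matrix.of t).mulVec (((Matrix.of t)⁻¹).mulVec 1) = 1 := by
      rw [Matrix.mulVec_mulVec, Matrix.mul_nonsing_inv _ (isUnit_iff_ne_zero.2 hdet),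
        Matrix.one_mulVec]
    rw [dotProduct_comm]
    exact congrFun h1 i
  obtain ⟨H, hH⟩ : ∃ H, H = |c 0| + |c 1| + |c 2| := ⟨_, rfl⟩
  have hH1 : 1 ≤ H := by
    rw [← hc 0, hH]; exact dotProduct_le_of_form_eq_one c (h.unit 0)
  obtain ⟨d, hd⟩ : ∃ d, ∀ i j, ‖gnomonic c (t i) - gnomonic c (t j)‖ ≤ d := by
    obtain ⟨q, hq⟩ := Finite.exists_max
      fun q : Fin 3 × Fin 3 => ‖gnomonic c (t q.1) - gnomonic c (t q.2)‖
    exact ⟨_, fun i j => hq (i, j)⟩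
  have hd0 : 0 ≤ d := (norm_nonneg _).trans (hd 0 0)
  set ρ := H / (1 + H) with hρ
  have hρ0 : 0 ≤ ρ := by positivity
  have hρ1 : ρ < 1 := by rw [hρ, div_lt_one (by linarith)]; linarith
  -- The summand 1 only keeps the denominator positive. N depends on the initial triangle and δ, not
  -- on the orbit.
  obtain ⟨N, hN⟩ := exists_pow_lt_of_lt_one
    (show 0 < δ / (6 * H ^ 2 * d ^ 2 + 1) by positivity) hρ1
  refine ⟨N, ?_⟩
  rintro s hs rfl
  have htri := hs.isTri (Or.inl rfl) h
  have hup : ∀ n i, c ⬝ᵥ s n i ≤ H := fun n i =>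
    hH ▸ dotProduct_le_of_form_eq_one c ((htri n).unit i)
  have key : ∀ n, (∀ i, 1 ≤ c ⬝ᵥ s n i) ∧
      ∀ i, ‖gnomonic c (s n (i + 1)) - gnomonic c (s n i)‖ ≤ ρ ^ n * d := by
    intro n
    induction n with
    | zero => exact ⟨fun i => (hc i).ge, fun i => by simpa using hd _ _⟩
    | succ n ih =>
      obtain ⟨h1, h2⟩ := ih
      have hn := htri n
      have hdist : ∀ i j, ‖gnomonic c (s n i) - gnomonic c (s n j)‖ ≤ ρ ^ n * d := by
        intro i j
        rcases fin3_cases i j with rfl | rfl | rfl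
        · simpa using by positivity
        · rw [norm_sub_rev]; exact h2 i
        · have := h2 (i + 2)
          rwa [fin3_add_two_one] at this
      obtain ⟨k, hk⟩ := hs n
      rw [hk, pow_succ', mul_assoc]
      cases k with
      | none =>
        constructor
        · intro i
          exact one_le_dotProduct_mid (hn.unit _) (hn.unit _) (hn.isSides i).u_gt (h1 _) (h1 _)
        · intro i
          have e1 := subdiv_none_prev 1 (s n) (i + 2)
          have e2 := subdiv_none_next 1 (s n) (i + 2)
          rw [fin3_add_two_two, fin3_add_two_one] at e1
          rw [fin3_add_two_two, fin3_add_two_one] at e2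
          rw [e1, e2]
          exact norm_gnomonic_mid_sub_le (hn.one_add_pos (by clear e1 e2; decide +revert))
            (hn.one_add_pos (by clear e1 e2; decide +revert)) (h1 _) (h1 _) (h1 _) (hup _ _) (hup _ _)
            (hdist _ _) (hdist _ _) (hdist _ _)
      | some k =>
        constructor
        · intro i
          rcases fin3_cases k i with rfl | rfl | rfl
          · rw [subdiv_some_self]; exact h1 _
          · rw [subdiv_some_next]
            exact one_le_dotProduct_mid (hn.unit _) (hn.unit _) (hn.one_add_next_pos _) (h1 _)
              (h1 _)
          · rw [subdiv_some_prev]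
            exact one_le_dotProduct_mid (hn.unit _) (hn.unit _) (hn.one_add_prev_pos _) (h1 _)
              (h1 _)
        · intro i
          rcases fin3_cases k i with rfl | rfl | rfl
          · rw [subdiv_some_self, subdiv_some_next]
            exact norm_gnomonic_mid_sub_left_le (hn.one_add_next_pos _) (h1 _) (h1 _) (hup _ _)
              (hdist _ _)
          · rw [fin3_add_one_one, subdiv_some_next, subdiv_some_prev]
            exact norm_gnomonic_mid_sub_le (hn.one_add_prev_pos _) (hn.one_add_next_pos _) (h1 _)
              (h1 _) (h1 _) (hup _ _) (hup _ _) (hdist _ _) (hdist _ _) (hdist _ _)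
          · rw [fin3_add_two_one, subdiv_some_self, subdiv_some_prev, norm_sub_rev]
            exact norm_gnomonic_mid_sub_left_le (hn.one_add_prev_pos _) (h1 _) (h1 _) (hup _ _)
              (hdist _ _)
  obtain ⟨h1, h2⟩ := key N
  have hside : ∀ i, 1 * (1 - sideCos 1 (s N) i) ≤ 2 * H ^ 2 * (ρ ^ N * d) ^ 2 := by
    intro i
    rw [one_mul]
    refine one_sub_form_le (c := c) ((htri N).unit _) ((htri N).unit _) (h1 _) (h1 _) (hup _ _)
      (hup _ _) ?_
    rw [norm_sub_rev, ← fin3_add_one_one]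
    exact h2 (i + 1)
  have hp0 : 0 ≤ ρ ^ N := by positivity
  have hp1 : ρ ^ N ≤ 1 := pow_le_one₀ hρ0 hρ1.le
  calc triSize 1 (s N) ≤ 6 * H ^ 2 * (ρ ^ N * d) ^ 2 := by
        unfold triSize; linarith [hside 0, hside 1, hside 2]
    _ = 6 * H ^ 2 * d ^ 2 * (ρ ^ N * ρ ^ N) := by ring
    _ ≤ 6 * H ^ 2 * d ^ 2 * (ρ ^ N * 1) := by gcongr
    _ ≤ ρ ^ N * (6 * H ^ 2 * d ^ 2 + 1) := by linarith
    _ ≤ δ := ((lt_div_iff₀ (by positivity)).1 hN).le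

/-! ### From the vector model to the geometries -/

/-- In the geometry `G`, the angles of subdivision triangles are uniformly comparable to those of
the original triangle, with constants which tend to `1` for small triangles. -/
def AnglesComparable (G : PlaneGeometry) : Prop :=
  ∃ l L : (Fin 3 → G.Point) → Fin 3 → ℝ,
    (∀ t₀, G.IsTriangle t₀ → ∀ i, 0 < l t₀ i ∧ 0 < L t₀ i) ∧
    (∀ t : ℕ → Fin 3 → G.Point, G.IsNested t → ∀ (i : Fin 3) (n : ℕ),
      G.vertexAngle (t 0) i * l (t 0) i < G.vertexAngle (t n) i ∧
      G.vertexAngle (t n) i < G.vertexAngle (t 0) i * L (t 0) i) ∧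
    (∀ ε > (0 : ℝ), ∃ δ > (0 : ℝ), ∀ t₀, G.IsTriangle t₀ →
      (∀ i j, G.dist (t₀ i) (t₀ j) < δ) →
        ∀ i, (1 - ε < l t₀ i ∧ l t₀ i < 1) ∧ (1 < L t₀ i ∧ L t₀ i < 1 + ε))

/-- The map `emb` identifies the geometry `G` with (part of) the unit vectors of `form σ`. -/
structure IsModel (G : PlaneGeometry) (σ : ℝ) (emb : G.Point → Fin 3 → ℝ) : Prop where
  unit : ∀ p, form σ (emb p) (emb p) = 1
  angle_eq : ∀ p q r, G.angle q p r = cosineLawAngle σ (form σ (emb q) (emb r))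
    (form σ (emb p) (emb r)) (form σ (emb p) (emb q))
  mid_eq : ∀ m p q, G.IsMidpoint m p q → 0 < 1 + form σ (emb p) (emb q) →
    emb m = mid σ (emb p) (emb q)
  isTri : ∀ t, G.IsTriangle t → IsTri σ fun i => emb (t i)
  small : ∀ δ > 0, ∃ η > 0, ∀ p q, G.dist p q < η → σ * (1 - form σ (emb p) (emb q)) < δ

section

variable {G : PlaneGeometry} {σ : ℝ} {emb : G.Point → Fin 3 → ℝ}

theorem IsModel.rescale (h : IsModel G σ emb) {c : ℝ} (hc : 0 < c) :
    IsModel (G.rescale c) σ emb where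
  unit := h.unit
  angle_eq := h.angle_eq
  mid_eq := by
    rintro m p q ⟨h1, h2⟩ hpq
    refine h.mid_eq m p q ⟨?_, ?_⟩ hpq
    · exact mul_left_cancel₀ hc.ne' (Eq.trans h1 (mul_div_assoc c _ 2))
    · exact mul_left_cancel₀ hc.ne' (Eq.trans h2 (mul_div_assoc c _ 2))
  isTri := h.isTri
  small := by
    intro δ hδ
    obtain ⟨η, hη, h⟩ := h.small δ hδ
    exact ⟨c * η, mul_pos hc hη, fun p q hpq => h p q (lt_of_mul_lt_mul_left hpq hc.le)⟩

theorem IsModel.vertexAngle_eq (h : IsModel G σ emb) (t : Fin 3 → G.Point) (i : Fin 3) :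
    G.vertexAngle t i = triAngle σ i fun j => emb (t j) := by
  rw [PlaneGeometry.vertexAngle, h.angle_eq, triAngle, ← form_self_next, ← form_self_prev]
  rfl

theorem IsModel.exists_subdiv (h : IsModel G σ emb) {t t' : Fin 3 → G.Point}
    (ht : IsTri σ fun j => emb (t j)) (hstep : G.IsInner t t' ∨ ∃ k, G.IsOuter k t t') :
    ∃ k, (fun j => emb (t' j)) = subdiv σ k fun j => emb (t j) := by
  rcases hstep with hin | ⟨k, hk, hout⟩
  · refine ⟨none, funext fun i => ?_⟩
    exact h.mid_eq _ _ _ (hin i) (ht.isSides i).u_gt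
  · refine ⟨some k, funext fun i => ?_⟩
    by_cases hi : i = k
    · subst hi; rw [subdiv_some_self, hk]
    · refine Eq.trans ?_ (if_neg hi).symm
      exact h.mid_eq _ _ _ (hout i hi) (ht.one_add_pos hi)

theorem IsModel.isOrbit (hσ : σ = 1 ∨ σ = -1) (h : IsModel G σ emb) {t : ℕ → Fin 3 → G.Point}
    (ht : G.IsNested t) : IsOrbit (subdiv σ) fun n j => emb (t n j) := by
  -- `mid_eq` excludes antipodal endpoints, so identifying a step requires the non-degeneracy of the
  -- current triangle, which is carried along.
  have key : ∀ n, IsTri σ fun j => emb (t n j) := by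
    intro n
    induction n with
    | zero => exact h.isTri _ ht.1
    | succ n ih =>
      obtain ⟨k, hk⟩ := h.exists_subdiv ih (ht.2 n)
      rw [hk]
      exact ih.subdiv hσ k
  exact fun n => h.exists_subdiv (key n) (ht.2 n)

theorem IsModel.anglesComparable (hσ : σ = 1 ∨ σ = -1) (h : IsModel G σ emb) :
    AnglesComparable G := by
  have hC : 0 < Real.pi * 4 := by positivity
  have hcontr : ∀ t k, IsTri σ t → triSize σ t ≤ 1 / 8 →
      triSize σ (subdiv σ k t) ≤ triSize σ t / 2 := by
    intro t k ht hs
    rcases hσ with rfl | rfl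
    · exact triSize_subdiv_le_of_pos ht (by linarith) k
    · exact triSize_subdiv_le_of_neg ht k
  have hev : ∀ t, IsTri σ t → ∀ δ > 0, ∃ N, ∀ s, IsOrbit (subdiv σ) s → s 0 = t →
      triSize σ (s N) ≤ δ := by
    intro t ht δ hδ
    rcases hσ with rfl | rfl
    · exact eventually_small_of_pos ht hδ
    · exact eventually_small_of_neg ht hδ
  have key := fun i => exists_orbit_bounds (step := subdiv σ) (T := IsTri σ) (a := triAngle σ i)
    (M := triSize σ) (fun t k ht => ht.subdiv hσ k) (fun t ht => ht.triAngle_pos hσ i)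
    (fun t ht => ht.triSize_pos) hC (by norm_num : (0 : ℝ) < 1 / 8)
    (fun t k ht hs => ht.abs_triAngle_sub_le hσ i k hs) hcontr hev
  choose l L hpos hbd hsmall using key
  refine ⟨fun t i => l i fun j => emb (t j), fun t i => L i fun j => emb (t j),
    fun t ht i => hpos i _ (h.isTri t ht), ?_, ?_⟩
  · intro t ht i n
    rw [h.vertexAngle_eq, h.vertexAngle_eq]
    exact hbd i _ (h.isOrbit hσ ht) (h.isTri _ ht.1) n
  · intro ε hε
    -- With three sides, 1/24 gives total size at most 1/8; the other bound gives 4 C M < min 1 ε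
    -- for C = 4π, which controls both explicit constants.
    obtain ⟨η, hη, hd⟩ := h.small (min (1 / 24) (min 1 ε / (12 * (Real.pi * 4)))) (by positivity)
    refine ⟨η, hη, fun t ht hdist i => ?_⟩
    have htri := h.isTri t ht
    have hM := htri.triSize_pos
    have hside : ∀ i, σ * (1 - sideCos σ (fun j => emb (t j)) i) <
        min (1 / 24) (min 1 ε / (12 * (Real.pi * 4))) := fun i => hd _ _ (hdist _ _)
    have h1 : triSize σ (fun j => emb (t j)) ≤ 1 / 8 := by
      have := fun i => (hside i).trans_le (min_le_left _ _)
      unfold triSize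
      linarith [this 0, this 1, this 2]
    have h2 : 4 * (Real.pi * 4) * triSize σ (fun j => emb (t j)) < min 1 ε := by
      have := fun i => (hside i).trans_le (min_le_right _ _)
      have h3 : triSize σ (fun j => emb (t j)) < 3 * (min 1 ε / (12 * (Real.pi * 4))) := by
        unfold triSize
        linarith [this 0, this 1, this 2]
      calc _ < 4 * (Real.pi * 4) * (3 * (min 1 ε / (12 * (Real.pi * 4)))) := by gcongr
        _ = min 1 ε := by field_simp; ring
    have h4 := h2.trans_le (min_le_left _ _)
    have h5 := h2.trans_le (min_le_right _ _)
    have h6 : 0 < Real.pi * 4 * triSize σ (fun j => emb (t j)) := by positivity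
    obtain ⟨hl, hL⟩ := hsmall i (fun j => emb (t j)) h1 (by linarith)
    simp only [hl, hL]
    refine ⟨⟨?_, ?_⟩, ?_, ?_⟩ <;> linarith

end

theorem gram_pos_of_linearIndependent {σ : ℝ} (hσ : σ = 1 ∨ σ = -1) {t : Fin 3 → Fin 3 → ℝ}
    (hu : ∀ i, form σ (t i) (t i) = 1) (h : LinearIndependent ℝ t) :
    0 < gram (sideCos σ t 0) (sideCos σ t 1) (sideCos σ t 2) := by
  rw [gram_sideCos (by rcases hσ with rfl | rfl <;> norm_num) hu]
  have h1 : IsUnit (Matrix.of t) := Matrix.linearIndependent_rows_iff_isUnit.1 h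
  have h2 := ((Matrix.isUnit_iff_isUnit_det _).1 h1).ne_zero
  positivity

/-! ### The hyperbolic plane -/

theorem form_neg_one (x y : Fin 3 → ℝ) : form (-1) x y = -lorentz x y := by
  unfold form lorentz; ring

theorem one_le_form_hyperboloid (p q : Hyperboloid) : 1 ≤ form (-1) p.1 q.1 := by
  obtain ⟨x, hx, hx2⟩ := p
  obtain ⟨y, hy, hy2⟩ := q
  unfold lorentz at hx hy
  simp only [form]
  have h : 1 + (x 0 * y 0 + x 1 * y 1) ≤ x 2 * y 2 := by
    apply le_of_sq_le_sq _ (by positivity)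
    have : (x 2 * y 2) ^ 2 = (1 + x 0 ^ 2 + x 1 ^ 2) * (1 + y 0 ^ 2 + y 1 ^ 2) := by
      rw [show (1 + x 0 ^ 2 + x 1 ^ 2) = x 2 ^ 2 by linarith,
        show (1 + y 0 ^ 2 + y 1 ^ 2) = y 2 ^ 2 by linarith]
      ring
    rw [this]
    nlinarith [sq_nonneg (x 0 - y 0), sq_nonneg (x 1 - y 1), sq_nonneg (x 0 * y 1 - x 1 * y 0)]
  linarith

theorem cosh_half_arcosh {w : ℝ} (hw : 1 ≤ w) : Real.cosh (Real.arcosh w / 2) = halfSide w := by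
  have h := Real.cosh_two_mul (Real.arcosh w / 2)
  rw [mul_div_cancel₀ _ (two_ne_zero), Real.cosh_arcosh hw, Real.sinh_sq] at h
  rw [halfSide, eq_comm, Real.sqrt_eq_iff_eq_sq (by positivity) (Real.cosh_pos _).le]
  linarith

theorem lorentz_hypDir (p q r : Hyperboloid) : lorentz (hypDir p q) (hypDir p r) =
    lorentz q.1 r.1 + lorentz p.1 q.1 * lorentz p.1 r.1 := by
  have hp := p.2.1
  simp only [hypDir, lorentz, Pi.add_apply, Pi.smul_apply, smul_eq_mul] at *
  linear_combination (p.1 0 * q.1 0 + p.1 1 * q.1 1 - p.1 2 * q.1 2) *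
    (p.1 0 * r.1 0 + p.1 1 * r.1 1 - p.1 2 * r.1 2) * hp

theorem form_hyperboloid_self (p : Hyperboloid) : form (-1) p.1 p.1 = 1 := by
  rw [form_neg_one, p.2.1, neg_neg]

theorem angle_hyperbolicPlane (p q r : Hyperboloid) : hyperbolicPlane.angle q p r =
    cosineLawAngle (-1) (form (-1) q.1 r.1) (form (-1) p.1 r.1) (form (-1) p.1 q.1) := by
  have h1 := one_le_form_hyperboloid p q
  have h2 := one_le_form_hyperboloid p r
  have hq := q.2.1
  have hr := r.2.1
  simp only [form_neg_one] at *
  change Real.arccos _ = Real.arccos _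
  rw [lorentz_hypDir, lorentz_hypDir, lorentz_hypDir, hq, hr, ← Real.sqrt_mul (by nlinarith)]
  congr 2
  · ring
  · congr 1; ring

theorem eq_mid_of_isMidpoint_hyperbolicPlane {m p q : Hyperboloid}
    (h : hyperbolicPlane.IsMidpoint m p q) (hpq : 0 < 1 + form (-1) p.1 q.1) :
    m.1 = mid (-1) p.1 q.1 := by
  obtain ⟨h1, h2⟩ := h
  change Real.arcosh (-lorentz p.1 m.1) = Real.arcosh (-lorentz p.1 q.1) / 2 at h1
  change Real.arcosh (-lorentz m.1 q.1) = Real.arcosh (-lorentz p.1 q.1) / 2 at h2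
  rw [← form_neg_one, ← form_neg_one] at h1 h2
  have e := cosh_half_arcosh (one_le_form_hyperboloid p q)
  apply eq_mid (Or.inr rfl) (form_hyperboloid_self _) (form_hyperboloid_self _)
    (form_hyperboloid_self _) hpq
  · rw [← e, ← h1, Real.cosh_arcosh (one_le_form_hyperboloid p m)]
  · rw [← e, ← h2, Real.cosh_arcosh (one_le_form_hyperboloid m q)]

theorem isTri_of_isTriangle_hyperbolicPlane {t : Fin 3 → Hyperboloid}
    (ht : LinearIndependent ℝ fun i => (t i).1) : IsTri (-1) fun i => (t i).1 := by
  have hu : ∀ i, form (-1) (t i).1 (t i).1 = 1 := fun i => form_hyperboloid_self _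
  have hone : ∀ i, 1 < sideCos (-1) (fun j => (t j).1) i := by
    intro i
    refine lt_of_le_of_ne (one_le_form_hyperboloid _ _) fun h => ?_
    exact fin3_add_one_ne_add_two i
      (ht.injective (eq_of_form_eq_one (Or.inr rfl) (hu _) (hu _) h.symm))
  refine ⟨hu, ?_, ?_, ?_, ?_, ?_, ?_, gram_pos_of_linearIndependent (Or.inr rfl) hu ht⟩ <;>
    linarith [hone 0, hone 1, hone 2]

theorem form_lt_of_dist_hyperbolicPlane_lt {δ : ℝ} (hδ : 0 < δ) : ∃ η > 0, ∀ p q : Hyperboloid,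
    hyperbolicPlane.dist p q < η → -1 * (1 - form (-1) p.1 q.1) < δ := by
  have hc : ContinuousAt Real.cosh 0 := Real.continuous_cosh.continuousAt
  obtain ⟨η, hη, h⟩ := Metric.continuousAt_iff.1 hc δ hδ
  refine ⟨η, hη, fun p q hpq => ?_⟩
  change Real.arcosh (-lorentz p.1 q.1) < η at hpq
  have h1 := one_le_form_hyperboloid p q
  rw [← form_neg_one] at hpq
  have := @h (Real.arcosh (form (-1) p.1 q.1)) (by
    rw [Real.dist_eq, sub_zero, abs_of_nonneg (Real.arcosh_nonneg h1)]; exact hpq)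
  rw [Real.dist_eq, Real.cosh_arcosh h1, Real.cosh_zero] at this
  linarith [(abs_lt.1 this).2]

theorem isModel_hyperbolicPlane :
    IsModel hyperbolicPlane (-1) (Subtype.val : Hyperboloid → Fin 3 → ℝ) where
  unit := form_hyperboloid_self
  angle_eq := angle_hyperbolicPlane
  mid_eq _ _ _ := eq_mid_of_isMidpoint_hyperbolicPlane
  isTri _ := isTri_of_isTriangle_hyperbolicPlane
  small _ := form_lt_of_dist_hyperbolicPlane_lt

/-! ### The sphere -/

theorem form_one (x y : EuclideanSpace ℝ (Fin 3)) : form 1 x.ofLp y.ofLp = inner ℝ x y := by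
  rw [PiLp.inner_apply, Fin.sum_univ_three]
  simp only [form, RCLike.inner_apply, conj_trivial]
  ring

theorem form_sphere_self (p : Sphere2) : form 1 p.1.ofLp p.1.ofLp = 1 := by
  rw [form_one, real_inner_self_eq_norm_sq, mem_sphere_zero_iff_norm.1 p.2, one_pow]

theorem abs_form_sphere_le (p q : Sphere2) : |form 1 p.1.ofLp q.1.ofLp| ≤ 1 := by
  rw [form_one]
  have := abs_real_inner_le_norm p.1 q.1
  rwa [mem_sphere_zero_iff_norm.1 p.2, mem_sphere_zero_iff_norm.1 q.2, one_mul] at this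

theorem angle_sphere (p q : Sphere2) :
    InnerProductGeometry.angle p.1 q.1 = Real.arccos (form 1 p.1.ofLp q.1.ofLp) := by
  rw [InnerProductGeometry.angle, mem_sphere_zero_iff_norm.1 p.2, mem_sphere_zero_iff_norm.1 q.2,
    one_mul, div_one, form_one]

theorem cos_half_arccos {w : ℝ} (hw : |w| ≤ 1) : Real.cos (Real.arccos w / 2) = halfSide w := by
  rw [halfSide, Real.cos_half (by linarith [Real.arccos_nonneg w, Real.pi_pos])
    (Real.arccos_le_pi w), Real.cos_arccos (abs_le.1 hw).1 (abs_le.1 hw).2]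

theorem inner_sphDir (p q r : Sphere2) : inner ℝ (sphDir p q) (sphDir p r) =
    inner ℝ q.1 r.1 - inner ℝ p.1 q.1 * inner ℝ p.1 r.1 := by
  simp only [sphDir, inner_sub_left, inner_sub_right, real_inner_smul_left, real_inner_smul_right,
    real_inner_self_eq_norm_sq, mem_sphere_zero_iff_norm.1 p.2, real_inner_comm p.1 q.1]
  ring

theorem angle_unitSphere (p q r : Sphere2) : unitSphere.angle q p r =
    cosineLawAngle 1 (form 1 q.1.ofLp r.1.ofLp) (form 1 p.1.ofLp r.1.ofLp)
      (form 1 p.1.ofLp q.1.ofLp) := by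
  have hq := abs_form_sphere_le p q
  have hq1 := form_sphere_self q
  have hr1 := form_sphere_self r
  simp only [form_one] at *
  change Real.arccos _ = Real.arccos _
  rw [norm_eq_sqrt_real_inner, norm_eq_sqrt_real_inner, inner_sphDir, inner_sphDir, inner_sphDir,
    hq1, hr1, ← Real.sqrt_mul (by nlinarith [abs_le.1 hq])]
  congr 2
  · ring
  · congr 1; ring

theorem eq_mid_of_isMidpoint_unitSphere {m p q : Sphere2} (h : unitSphere.IsMidpoint m p q)
    (hpq : 0 < 1 + form 1 p.1.ofLp q.1.ofLp) : m.1.ofLp = mid 1 p.1.ofLp q.1.ofLp := by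
  obtain ⟨h1, h2⟩ := h
  change InnerProductGeometry.angle p.1 m.1 = InnerProductGeometry.angle p.1 q.1 / 2 at h1
  change InnerProductGeometry.angle m.1 q.1 = InnerProductGeometry.angle p.1 q.1 / 2 at h2
  rw [angle_sphere, angle_sphere] at h1 h2
  have e := cos_half_arccos (abs_form_sphere_le p q)
  apply eq_mid (Or.inl rfl) (form_sphere_self _) (form_sphere_self _) (form_sphere_self _) hpq
  · have h := abs_le.1 (abs_form_sphere_le p m)
    rw [← e, ← h1, Real.cos_arccos h.1 h.2]
  · have h := abs_le.1 (abs_form_sphere_le m q)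
    rw [← e, ← h2, Real.cos_arccos h.1 h.2]

theorem isTri_of_isTriangle_unitSphere {t : Fin 3 → Sphere2}
    (hli : LinearIndependent ℝ fun i => (t i).1)
    (hv : ∃ v : EuclideanSpace ℝ (Fin 3), ∀ i, 0 < inner ℝ v (t i).1) :
    IsTri 1 fun i => (t i).1.ofLp := by
  obtain ⟨v, hv⟩ := hv
  have hli' : LinearIndependent ℝ fun i => (t i).1.ofLp :=
    hli.map' (WithLp.linearEquiv 2 ℝ (Fin 3 → ℝ)).toLinearMap (LinearEquiv.ker _)
  have hu : ∀ i, form 1 (t i).1.ofLp (t i).1.ofLp = 1 := fun i => form_sphere_self _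
  have hlt : ∀ i, sideCos 1 (fun j => (t j).1.ofLp) i < 1 := by
    intro i
    refine lt_of_le_of_ne (abs_le.1 (abs_form_sphere_le _ _)).2 fun h => ?_
    exact fin3_add_one_ne_add_two i
      (hli'.injective (eq_of_form_eq_one (Or.inl rfl) (hu _) (hu _) h))
  have hgt : ∀ i, -1 < sideCos 1 (fun j => (t j).1.ofLp) i := by
    intro i
    -- Equality would make two vertices antipodal, which the open hemisphere forbids.
    refine lt_of_le_of_ne (abs_le.1 (abs_form_sphere_le _ _)).1 fun h => ?_
    have h1 := hv (i + 1)
    have h2 := hv (i + 2)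
    have h3 : (t (i + 1)).1.ofLp = -(t (i + 2)).1.ofLp := by
      have hneg : ∀ x y : Fin 3 → ℝ, form 1 x (-y) = -form 1 x y := fun x y => by
        simp only [form, Pi.neg_apply]; ring
      apply eq_of_form_eq_one (Or.inl rfl) (hu _)
      · rw [hneg, form_comm, hneg, neg_neg, hu]
      · rw [hneg, neg_eq_iff_eq_neg]
        exact h.symm
    rw [← form_one, h3] at h1
    rw [← form_one] at h2
    simp only [form, Pi.neg_apply] at h1 h2
    linarith
  refine ⟨hu, ?_, ?_, ?_, ?_, ?_, ?_, gram_pos_of_linearIndependent (Or.inl rfl) hu hli'⟩ <;>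
    linarith [hlt 0, hlt 1, hlt 2, hgt 0, hgt 1, hgt 2]

theorem form_lt_of_dist_unitSphere_lt {δ : ℝ} (hδ : 0 < δ) : ∃ η > 0, ∀ p q : Sphere2,
    unitSphere.dist p q < η → 1 * (1 - form 1 p.1.ofLp q.1.ofLp) < δ := by
  have hc : ContinuousAt Real.cos 0 := Real.continuous_cos.continuousAt
  obtain ⟨η, hη, h⟩ := Metric.continuousAt_iff.1 hc δ hδ
  refine ⟨η, hη, fun p q hpq => ?_⟩
  change InnerProductGeometry.angle p.1 q.1 < η at hpq
  have h1 := abs_le.1 (abs_form_sphere_le p q)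
  rw [angle_sphere] at hpq
  have := @h (Real.arccos (form 1 p.1.ofLp q.1.ofLp)) (by
    rw [Real.dist_eq, sub_zero, abs_of_nonneg (Real.arccos_nonneg _)]; exact hpq)
  rw [Real.dist_eq, Real.cos_arccos h1.1 h1.2, Real.cos_zero] at this
  linarith [(abs_lt.1 this).1]

theorem isModel_unitSphere : IsModel unitSphere 1 fun p : Sphere2 => p.1.ofLp where
  unit := form_sphere_self
  angle_eq := angle_unitSphere
  mid_eq _ _ _ := eq_mid_of_isMidpoint_unitSphere
  isTri _ ht := isTri_of_isTriangle_unitSphere ht.1 ht.2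
  small _ := form_lt_of_dist_unitSphere_lt

/-! ### The Euclidean plane -/

section

variable {t t' : Fin 3 → EuclideanSpace ℝ (Fin 2)}

theorem angle_eq_of_sub_eq_smul {p q r p' q' r' : EuclideanSpace ℝ (Fin 2)} {c : ℝ} (hc : c ≠ 0)
    (hq : q' - p' = c • (q - p)) (hr : r' - p' = c • (r - p)) :
    EuclideanGeometry.angle q' p' r' = EuclideanGeometry.angle q p r := by
  unfold EuclideanGeometry.angle
  rw [vsub_eq_sub, vsub_eq_sub, vsub_eq_sub, vsub_eq_sub, hq, hr,
    InnerProductGeometry.angle_smul_smul hc]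

theorem eq_of_isMidpoint {m p q : EuclideanSpace ℝ (Fin 2)} (h : euclideanPlane.IsMidpoint m p q) :
    m = (1 / 2 : ℝ) • (p + q) := by
  obtain ⟨h1, h2⟩ := h
  change dist p m = dist p q / 2 at h1
  change dist m q = dist p q / 2 at h2
  have : m = midpoint ℝ p q := eq_midpoint_of_dist_eq_half h1 h2
  rw [this, midpoint_eq_smul_add]
  norm_num

/-- The inner triangle is the image of the original under a homothety of ratio -1/2. -/
theorem vertexAngle_eq_of_isInner (h : euclideanPlane.IsInner t t') (i : Fin 3) :
    euclideanPlane.vertexAngle t' i = euclideanPlane.vertexAngle t i := by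
  have h0 := eq_of_isMidpoint (h i)
  have h1 := eq_of_isMidpoint (h (i + 1))
  have h2 := eq_of_isMidpoint (h (i + 2))
  rw [fin3_add_one_one, fin3_add_one_two] at h1
  rw [fin3_add_two_one, fin3_add_two_two] at h2
  refine angle_eq_of_sub_eq_smul (c := -(1 / 2)) (by norm_num) ?_ ?_
  · rw [h0, h1]; module
  · rw [h0, h2]; module

theorem vertexAngle_eq_of_isOuter {k : Fin 3} (h : euclideanPlane.IsOuter k t t') (i : Fin 3) :
    euclideanPlane.vertexAngle t' i = euclideanPlane.vertexAngle t i := by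
  have key : ∀ i, t' i = (1 / 2 : ℝ) • (t k + t i) := by
    intro i
    by_cases hi : i = k
    · subst hi
      rw [h.1]; module
    · exact eq_of_isMidpoint (h.2 i hi)
  refine angle_eq_of_sub_eq_smul (c := 1 / 2) (by norm_num) ?_ ?_
  · rw [key, key]; module
  · rw [key, key]; module

theorem vertexAngle_eq_of_isNested {t : ℕ → Fin 3 → EuclideanSpace ℝ (Fin 2)}
    (h : euclideanPlane.IsNested t) (i : Fin 3) (n : ℕ) :
    euclideanPlane.vertexAngle (t n) i = euclideanPlane.vertexAngle (t 0) i := by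
  induction n with
  | zero => rfl
  | succ n ih =>
    rw [← ih]
    rcases h.2 n with hin | ⟨k, hout⟩
    · exact vertexAngle_eq_of_isInner hin i
    · exact vertexAngle_eq_of_isOuter hout i

theorem vertexAngle_euclideanPlane_pos (h : AffineIndependent ℝ t) (i : Fin 3) :
    0 < euclideanPlane.vertexAngle t i := by
  refine lt_of_le_of_ne (EuclideanGeometry.angle_nonneg _ _ _) fun h0 => ?_
  have hcol := EuclideanGeometry.collinear_of_angle_eq_zero h0.symm
  rw [affineIndependent_iff_not_collinear] at h
  apply h
  refine hcol.subset ?_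
  rintro _ ⟨j, rfl⟩
  rcases fin3_cases i j with rfl | rfl | rfl <;> simp

theorem anglesComparable_euclideanPlane : AnglesComparable euclideanPlane := by
  have hdist : ∀ t : Fin 3 → EuclideanSpace ℝ (Fin 2), AffineIndependent ℝ t →
      0 < dist (t 0) (t 1) := fun t ht => dist_pos.2 (ht.injective.ne (by decide))
  -- The angles are constant, but the constants must differ strictly from 1 and tend to 1, so one
  -- side length serves as the margin.
  refine ⟨fun t _ => 1 / (1 + euclideanPlane.dist (t 0) (t 1)),
    fun t _ => 1 + euclideanPlane.dist (t 0) (t 1), ?_, ?_, ?_⟩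
  · intro t ht i
    have : 0 < euclideanPlane.dist (t 0) (t 1) := hdist t ht
    exact ⟨by positivity, by positivity⟩
  · intro t ht i n
    have h1 : 0 < euclideanPlane.dist (t 0 0) (t 0 1) := hdist _ ht.1
    have h2 : 0 < euclideanPlane.vertexAngle (t 0) i := vertexAngle_euclideanPlane_pos ht.1 i
    rw [vertexAngle_eq_of_isNested ht i n]
    refine ⟨mul_lt_of_lt_one_right h2 ?_, lt_mul_of_one_lt_right h2 (by linarith)⟩
    rw [div_lt_one (by linarith)]
    linarith
  · intro ε hε
    refine ⟨ε, hε, fun t ht hd i => ?_⟩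
    have h1 : 0 < euclideanPlane.dist (t 0) (t 1) := hdist t ht
    have h2 := hd 0 1
    refine ⟨⟨?_, ?_⟩, by linarith, by linarith⟩
    · rw [lt_div_iff₀ (by linarith)]
      nlinarith
    · rw [div_lt_one (by linarith)]
      linarith

end

theorem anglesComparable_constCurv (κ : ℝ) : AnglesComparable (constCurv κ) := by
  rcases lt_trichotomy κ 0 with h | rfl | h
  · rw [constCurv, if_pos h]
    have : 0 < √(-κ) := Real.sqrt_pos.2 (by linarith)
    exact (isModel_hyperbolicPlane.rescale (by positivity)).anglesComparable (Or.inr rfl)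
  · rw [constCurv, if_neg (lt_irrefl _), if_pos rfl]
    exact anglesComparable_euclideanPlane
  · rw [constCurv, if_neg h.le.not_gt, if_neg h.ne']
    have : 0 < √κ := Real.sqrt_pos.2 h
    exact (isModel_unitSphere.rescale (by positivity)).anglesComparable (Or.inl rfl)

end MedialSubdivision

end

theorem theoremB (κ : ℝ) :
    ∃ l L : (Fin 3 → (MedialSubdivision.constCurv κ).Point) → Fin 3 → ℝ,
      (∀ t₀, (MedialSubdivision.constCurv κ).IsTriangle t₀ → ∀ i, 0 < l t₀ i ∧ 0 < L t₀ i) ∧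
      (∀ t : ℕ → Fin 3 → (MedialSubdivision.constCurv κ).Point,
        (MedialSubdivision.constCurv κ).IsNested t → ∀ (i : Fin 3) (n : ℕ),
          (MedialSubdivision.constCurv κ).vertexAngle (t 0) i * l (t 0) i
              < (MedialSubdivision.constCurv κ).vertexAngle (t n) i ∧
          (MedialSubdivision.constCurv κ).vertexAngle (t n) i
              < (MedialSubdivision.constCurv κ).vertexAngle (t 0) i * L (t 0) i) ∧
      (∀ ε > (0 : ℝ), ∃ δ > (0 : ℝ), ∀ t₀, (MedialSubdivision.constCurv κ).IsTriangle t₀ →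
        (∀ i j, (MedialSubdivision.constCurv κ).dist (t₀ i) (t₀ j) < δ) →
          ∀ i, (1 - ε < l t₀ i ∧ l t₀ i < 1) ∧ (1 < L t₀ i ∧ L t₀ i < 1 + ε)) := by
  exact MedialSubdivision.anglesComparable_constCurv κ
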